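/- Let $p\ge 0$, let $M,H\in\mathbb R^{p\times p}$ be symmetric positive semidefinite, $\varphi,\psi\in\mathbb R^p$, $\kappa\in[0,\infty)^p$, and let $d>\|M\|$, $e>\|H\|$ (spectral norms). For $\beta\in\mathbb R^p$ let $\theta=\theta(\beta)$ be the soft thresholding $\theta_j=\operatorname{sign}(\beta_j)(|\beta_j|-\kappa_j)_+$. Assume that the posterior is proper, i.e. that $$\Pi(\beta)=\exp\Big[-\tfrac12(\theta'M\theta-2\varphi'\theta)\Big]\exp\Big[-\tfrac12(\beta'H\beta-2\psi'\beta)\Big]$$ is Lebesgue integrable on $\mathbb R^p$. Given $\beta$, let $r\sim N((dI-M)\theta,\,dI-M)$ and $t\sim N((eI-H)\beta,\,eI-H)$ be independent; this defines the conditional law of $(r,t)$ given $\beta$. Let $\mu_{\beta,r,t}$ be the joint law of $(\beta,r,t)$ when $\beta$ has the normalized density $\propto\Pi(\beta)$, and let $\mu_{r,t}$ be its $(r,t)$-marginal. Given $(r,t)$, let $\beta$ have independent coordinates, $\beta_j$ being drawn from the following mixture over $b_j\in\{0,1,-1\}$. In component $b$, $\beta_j$ is Gaussian truncated to $(-\kappa_j,\kappa_j)$,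 $(\kappa_j,\infty)$, $(-\infty,-\kappa_j)$ for $b=0,1,-1$ respectively, with mean (before truncation) and precision $$a_0=\frac{\psi_j+t_j}{e},\quad \tau_0=e;\qquad a_{\pm1}=\frac{\varphi_j+r_j+\psi_j+t_j\pm d\kappa_j}{d+e},\quad \tau_{\pm1}=d+e.$$ The probability of component $b$ is proportional to $m_b^{-1}\exp(E_b)$, where $m_b^{-1}$ is the integral of $\exp[-\tfrac{\tau_b}2(x-a_b)^2]$ over the truncation interval, $E_0=\frac{(\psi_j+t_j)^2}{2e}$ and $E_{\pm1}=\frac{(\varphi_j+r_j+\psi_j+t_j\pm d\kappa_j)^2}{2(d+e)}-\tfrac12 d\kappa_j^2\mp(\varphi_j+r_j)\kappa_j$. Let $\mathcal K$ be the transition kernel of the two-block Gibbs sampler: from $(\beta^m,r^m,t^m)$ draw $\beta^{m+1}$ given $(r^m,t^m)$ from this mixture, and then $(r^{m+1},t^{m+1})$ given $\beta^{m+1}$ from the Gaussian laws above. Let $P^m_{\beta,r,t}$ be the law of $(\beta^m,r^m,t^m)$ for the chain started at $(\beta^0,r^0,t^0)$, and $P^m_{r,t}$ that of $(r^m,t^m)$;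 for $m\ge1$ they depend on $(r^0,t^0)$ only. Let $\|\mu-\nu\|_{TV}=\sup_A|\mu(A)-\nu(A)|$. Then $\mathcal K$ is a Markov kernel with invariant probability measure $\mu_{\beta,r,t}$, and it is geometrically ergodic, with the same rate as the marginal chain: there are $\gamma\in(0,1)$ and real-valued functions $C_1,C_2$ of $(r^0,t^0)$ such that, for all $m\ge0$ and all $(\beta^0,r^0,t^0)$, $$\|P^m_{r,t}-\mu_{r,t}\|_{TV}\le C_1(r^0,t^0)\gamma^m\qquad\text{and}\qquad \|P^m_{\beta,r,t}-\mu_{\beta,r,t}\|_{TV}\le C_2(r^0,t^0)\gamma^m.$$ Moreover, whenever the first bound holds for some $\gamma\in(0,1)$ with some function $C_1$, the second holds for the same $\gamma$ with some function $C_2$. -/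

import Mathlib

open MeasureTheory ProbabilityTheory

noncomputable section

namespace AntiCorr

/-- `ℝᵖ` with its Euclidean structure. -/
abbrev Vec (p : ℕ) : Type := EuclideanSpace ℝ (Fin p)

/-- State space of the pair of latent variables `(r, t)`. -/
abbrev Latent (p : ℕ) : Type := Vec p × Vec p

/-- State space of the full chain `(β, (r, t))`. -/
abbrev State (p : ℕ) : Type := Vec p × Latent p

/-- The linear map `x ↦ A x` on `ℝᵖ` (its operator norm is the spectral norm of `A`). -/
abbrev matMap {p : ℕ} (A : Matrix (Fin p) (Fin p) ℝ) : Vec p →L[ℝ] Vec p :=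
  Matrix.toEuclideanCLM (n := Fin p) (𝕜 := ℝ) A

/-- Soft thresholding `θ = sign(β) ∘ (|β| - κ)₊`, coordinatewise. -/
def softThreshold {p : ℕ} (κ β : Vec p) : Vec p :=
  WithLp.toLp 2 fun j => Real.sign (β j) * max (|β j| - κ j) 0

/-! ### The target posterior -/

/-- Unnormalized posterior density of `β`,
`exp[-(θ'Mθ - 2φ'θ)/2] · exp[-(β'Hβ - 2ψ'β)/2]` with `θ` the soft thresholding of `β`. -/
def posteriorDensity {p : ℕ} (M H : Matrix (Fin p) (Fin p) ℝ) (φ ψ κ β : Vec p) : ℝ :=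
  Real.exp (-(1 / 2) * (inner ℝ (softThreshold κ β) (matMap M (softThreshold κ β))
      - 2 * inner ℝ φ (softThreshold κ β))) *
    Real.exp (-(1 / 2) * (inner ℝ β (matMap H β) - 2 * inner ℝ ψ β))

/-- Posterior distribution of `β`: the unnormalized density times Lebesgue measure, normalized. -/
def posterior {p : ℕ} (M H : Matrix (Fin p) (Fin p) ℝ) (φ ψ κ : Vec p) : Measure (Vec p) :=
  (∫⁻ β, ENNReal.ofReal (posteriorDensity M H φ ψ κ β))⁻¹ •
    volume.withDensity fun β => ENNReal.ofReal (posteriorDensity M H φ ψ κ β)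

/-! ### The anti-correlation Gaussian update of `(r, t)` given `β` -/

/-- `x ↦ N((c I - A) x, c I - A)`. -/
def antiGaussian {p : ℕ} (c : ℝ) (A : Matrix (Fin p) (Fin p) ℝ) (x : Vec p) : Measure (Vec p) :=
  multivariateGaussian
    (matMap (c • (1 : Matrix (Fin p) (Fin p) ℝ) - A) x)
    (c • (1 : Matrix (Fin p) (Fin p) ℝ) - A)

theorem measurable_softThreshold {p : ℕ} (κ : Vec p) : Measurable (softThreshold κ) := by
  have hs : Measurable Real.sign :=
    Measurable.ite measurableSet_Iio measurable_const
      (Measurable.ite measurableSet_Ioi measurable_const measurable_const)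
  unfold softThreshold
  refine (WithLp.measurable_toLp 2 _).comp (measurable_pi_lambda _ fun j => ?_)
  have hj : Measurable fun β : Vec p => β j := by fun_prop
  exact (hs.comp hj).mul ((((continuous_abs.measurable.comp hj).sub_const _)).max measurable_const)

theorem measurable_map_add {p : ℕ} (ν : Measure (Vec p)) [SFinite ν] (f g : Vec p →L[ℝ] Vec p) :
    Measurable fun x => ν.map fun y => f x + g y := by
  refine Measure.measurable_of_measurable_coe _ fun s hs => ?_
  have h : ∀ x : Vec p, Measurable fun y : Vec p => f x + g y := fun x => by fun_prop
  have h' : Measurable fun q : Vec p × Vec p => f q.1 + g q.2 := by fun_prop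
  simp_rw [Measure.map_apply (h _) hs]
  exact measurable_measure_prodMk_left (h' hs)

theorem measurable_antiGaussian {p : ℕ} (c : ℝ) (A : Matrix (Fin p) (Fin p) ℝ) :
    Measurable (antiGaussian c A) := by
  unfold antiGaussian multivariateGaussian
  exact measurable_map_add _ _ _

/-- The kernel `x ↦ N((c I - A) x, c I - A)`. -/
def antiGaussianKernel {p : ℕ} (c : ℝ) (A : Matrix (Fin p) (Fin p) ℝ) : Kernel (Vec p) (Vec p) where
  toFun := antiGaussian c A
  measurable' := measurable_antiGaussian c A

instance {p : ℕ} (c : ℝ) (A : Matrix (Fin p) (Fin p) ℝ) :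
    IsMarkovKernel (antiGaussianKernel c A) where
  isProbabilityMeasure x := by
    change IsProbabilityMeasure (antiGaussian c A x)
    unfold antiGaussian
    infer_instance

/-- Law of `(r, t)` given `β`: independently, `r ~ N((d I - M) θ, d I - M)` with `θ` the soft
thresholding of `β`, and `t ~ N((e I - H) β, e I - H)`. -/
def latentKernel {p : ℕ} (M H : Matrix (Fin p) (Fin p) ℝ) (κ : Vec p) (d e : ℝ) :
    Kernel (Vec p) (Latent p) :=
  ((antiGaussianKernel d M).comap (softThreshold κ) (measurable_softThreshold κ)) ×ₖ
    antiGaussianKernel e H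

/-! ### The mixture update of `β` given `(r, t)` -/

/-- `m⁻¹`, where `m` is the factor in front of the exponential in the density of the Gaussian with
mean `a` and variance `1 / τ` truncated to `s`. -/
def truncMass (a τ : ℝ) (s : Set ℝ) : ℝ := ∫ x in s, Real.exp (-(τ / 2) * (x - a) ^ 2)

/-- The Gaussian distribution with mean `a` and variance `1 / τ`, truncated to `s`. -/
def truncGaussian (a τ : ℝ) (s : Set ℝ) : Measure ℝ :=
  (volume.restrict s).withDensity fun x =>
    ENNReal.ofReal ((truncMass a τ s)⁻¹ * Real.exp (-(τ / 2) * (x - a) ^ 2))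

/-- Range of `β_j` in the component `b_j`. -/
def compSupport (κ : ℝ) : SignType → Set ℝ
  | .zero => Set.Ioo (-κ) κ
  | .pos => Set.Ioi κ
  | .neg => Set.Iio (-κ)

/-- Precision of the Gaussian in the component `b_j`. -/
def compPrec (d e : ℝ) : SignType → ℝ
  | .zero => e
  | .pos => d + e
  | .neg => d + e

/-- Mean (before truncation) of the Gaussian in the component `b_j`. -/
def compMean (φ ψ κ d e r t : ℝ) : SignType → ℝ
  | .zero => (ψ + t) / e
  | .pos => (φ + r + ψ + t + d * κ) / (d + e)
  | .neg => (φ + r + ψ + t - d * κ) / (d + e)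

/-- The exponent in the probability of the component `b_j`. -/
def compExponent (φ ψ κ d e r t : ℝ) : SignType → ℝ
  | .zero => 1 / 2 * ((ψ + t) ^ 2 / e)
  | .pos => 1 / 2 * ((φ + r + ψ + t + d * κ) ^ 2 / (d + e)) - 1 / 2 * d * κ ^ 2 - (φ + r) * κ
  | .neg => 1 / 2 * ((φ + r + ψ + t - d * κ) ^ 2 / (d + e)) - 1 / 2 * d * κ ^ 2 + (φ + r) * κ

/-- Unnormalized probability `m_b⁻¹ exp(...)` of the component `b_j`. -/
def compWeight (φ ψ κ d e r t : ℝ) (b : SignType) : ℝ :=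
  truncMass (compMean φ ψ κ d e r t b) (compPrec d e b) (compSupport κ b) *
    Real.exp (compExponent φ ψ κ d e r t b)

/-- Probability of the component `b_j`. -/
def compProb (φ ψ κ d e r t : ℝ) (b : SignType) : ℝ :=
  compWeight φ ψ κ d e r t b / ∑ b' : SignType, compWeight φ ψ κ d e r t b'

/-- Law of `β_j` given `(r_j, t_j)`: draw `b_j`, then `β_j` from the corresponding truncated
Gaussian. -/
def coordLaw (φ ψ κ d e r t : ℝ) : Measure ℝ :=
  ∑ b : SignType, ENNReal.ofReal (compProb φ ψ κ d e r t b) •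
    truncGaussian (compMean φ ψ κ d e r t b) (compPrec d e b) (compSupport κ b)

/-- Law of `β` given `(r, t)`: independent coordinates. -/
def blockLaw {p : ℕ} (φ ψ κ : Vec p) (d e : ℝ) (q : Latent p) : Measure (Vec p) :=
  (Measure.pi fun j => coordLaw (φ j) (ψ j) (κ j) d e (q.1 j) (q.2 j)).map (WithLp.toLp 2)

theorem measurableSet_compSupport (κ : ℝ) (b : SignType) : MeasurableSet (compSupport κ b) := by
  cases b
  · exact measurableSet_Ioo
  · exact measurableSet_Iio
  · exact measurableSet_Ioi

theorem measurable_truncMass (τ : ℝ) (s : Set ℝ) : Measurable fun a => truncMass a τ s := by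
  unfold truncMass
  have h : StronglyMeasurable fun q : ℝ × ℝ => Real.exp (-(τ / 2) * (q.2 - q.1) ^ 2) :=
    (by fun_prop : Continuous fun q : ℝ × ℝ =>
      Real.exp (-(τ / 2) * (q.2 - q.1) ^ 2)).stronglyMeasurable
  exact (h.integral_prod_right (ν := volume.restrict s)).measurable

theorem measurable_truncGaussian (τ : ℝ) {s : Set ℝ} :
    Measurable fun a => truncGaussian a τ s := by
  refine Measure.measurable_of_measurable_coe _ fun A hA => ?_
  simp only [truncGaussian, withDensity_apply _ hA]
  have h : Measurable fun q : ℝ × ℝ =>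
      ENNReal.ofReal ((truncMass q.1 τ s)⁻¹ * Real.exp (-(τ / 2) * (q.2 - q.1) ^ 2)) := by
    have h1 : Measurable fun q : ℝ × ℝ => (truncMass q.1 τ s)⁻¹ :=
      ((measurable_truncMass τ s).comp measurable_fst).inv
    exact (h1.mul (by fun_prop)).ennreal_ofReal
  exact h.lintegral_prod_right'

theorem truncGaussian_univ_le (a τ : ℝ) (s : Set ℝ) : truncGaussian a τ s Set.univ ≤ 1 := by
  rw [truncGaussian, withDensity_apply _ MeasurableSet.univ, Measure.restrict_univ]
  by_cases hi : IntegrableOn (fun x => Real.exp (-(τ / 2) * (x - a) ^ 2)) s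
  · have h0 : 0 ≤ truncMass a τ s := integral_nonneg fun x => (Real.exp_pos _).le
    rw [← ofReal_integral_eq_lintegral_ofReal (hi.const_mul _)
      (Filter.Eventually.of_forall fun x => mul_nonneg (inv_nonneg.2 h0) (Real.exp_pos _).le),
      integral_const_mul]
    change ENNReal.ofReal ((truncMass a τ s)⁻¹ * truncMass a τ s) ≤ 1
    rw [← ENNReal.ofReal_one]
    exact ENNReal.ofReal_le_ofReal (inv_mul_le_one_of_le₀ le_rfl h0)
  · have : truncMass a τ s = 0 := integral_undef hi
    simp [this]

instance (a τ : ℝ) (s : Set ℝ) : IsFiniteMeasure (truncGaussian a τ s) :=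
  ⟨(truncGaussian_univ_le a τ s).trans_lt ENNReal.one_lt_top⟩

instance (φ ψ κ d e r t : ℝ) : IsFiniteMeasure (coordLaw φ ψ κ d e r t) := by
  refine ⟨?_⟩
  simp only [coordLaw, Measure.finsetSum_apply, Measure.smul_apply, smul_eq_mul]
  exact ENNReal.sum_lt_top.2 fun b _ => ENNReal.mul_lt_top ENNReal.ofReal_lt_top
    (measure_lt_top _ _)

theorem measurable_compMean (φ ψ κ d e : ℝ) (b : SignType) :
    Measurable fun q : ℝ × ℝ => compMean φ ψ κ d e q.1 q.2 b := by
  cases b <;> simp only [compMean] <;> fun_prop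

theorem measurable_compExponent (φ ψ κ d e : ℝ) (b : SignType) :
    Measurable fun q : ℝ × ℝ => compExponent φ ψ κ d e q.1 q.2 b := by
  cases b <;> simp only [compExponent] <;> fun_prop

theorem measurable_compWeight (φ ψ κ d e : ℝ) (b : SignType) :
    Measurable fun q : ℝ × ℝ => compWeight φ ψ κ d e q.1 q.2 b :=
  ((measurable_truncMass _ _).comp (measurable_compMean φ ψ κ d e b)).mul
    (measurable_compExponent φ ψ κ d e b).exp

theorem measurable_coordLaw (φ ψ κ d e : ℝ) :
    Measurable fun q : ℝ × ℝ => coordLaw φ ψ κ d e q.1 q.2 := by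
  refine Measure.measurable_of_measurable_coe _ fun A hA => ?_
  simp only [coordLaw, Measure.finsetSum_apply, Measure.smul_apply, smul_eq_mul]
  refine Finset.measurable_sum _ fun b _ => Measurable.mul ?_ ?_
  · exact ((measurable_compWeight φ ψ κ d e b).div
      (Finset.measurable_sum _ fun b' _ => measurable_compWeight φ ψ κ d e b')).ennreal_ofReal
  · exact (Measure.measurable_coe hA).comp
      ((measurable_truncGaussian _).comp (measurable_compMean φ ψ κ d e b))

theorem measurable_measurePi {α : Type*} [MeasurableSpace α] {p : ℕ} (ν : α → Fin p → Measure ℝ)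
    [∀ a j, IsFiniteMeasure (ν a j)] (hν : ∀ j, Measurable fun a => ν a j) :
    Measurable fun a => Measure.pi (ν a) := by
  refine Measurable.measure_of_isPiSystem generateFrom_pi.symm isPiSystem_pi ?_ ?_
  · rintro _ ⟨s, hs, rfl⟩
    simp only [Measure.pi_pi]
    refine Finset.measurable_prod _ fun j _ => ?_
    have hj : MeasurableSet (s j) := hs j (Set.mem_univ j)
    exact (Measure.measurable_coe hj).comp (hν j)
  · simp only [Measure.pi_univ]
    exact Finset.measurable_prod _ fun j _ => (Measure.measurable_coe MeasurableSet.univ).comp (hν j)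

theorem measurable_coordLaw_eval {p : ℕ} (φ ψ κ : Vec p) (d e : ℝ) (j : Fin p) :
    Measurable fun q : Latent p => coordLaw (φ j) (ψ j) (κ j) d e (q.1 j) (q.2 j) := by
  have h : Measurable fun q : Latent p => (q.1 j, q.2 j) := by fun_prop
  have h2 := measurable_coordLaw (φ j) (ψ j) (κ j) d e
  have h3 : Measurable fun q : Latent p =>
      (fun q' : ℝ × ℝ => coordLaw (φ j) (ψ j) (κ j) d e q'.1 q'.2) (q.1 j, q.2 j) := h2.comp h
  exact h3

theorem measurable_blockLaw {p : ℕ} (φ ψ κ : Vec p) (d e : ℝ) :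
    Measurable (blockLaw φ ψ κ d e) := by
  have hpi := measurable_measurePi
    (fun (q : Latent p) (j : Fin p) => coordLaw (φ j) (ψ j) (κ j) d e (q.1 j) (q.2 j))
    (measurable_coordLaw_eval φ ψ κ d e)
  have hm : Measurable fun ν : Measure (Fin p → ℝ) => ν.map (WithLp.toLp 2 : _ → Vec p) :=
    Measure.measurable_map _ (WithLp.measurable_toLp 2 _)
  exact hm.comp hpi

/-- The kernel drawing `β` given `(r, t)`. -/
def blockKernel {p : ℕ} (φ ψ κ : Vec p) (d e : ℝ) : Kernel (Latent p) (Vec p) where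
  toFun := blockLaw φ ψ κ d e
  measurable' := measurable_blockLaw φ ψ κ d e

theorem compWeight_nonneg (φ ψ κ d e r t : ℝ) (b : SignType) :
    0 ≤ compWeight φ ψ κ d e r t b :=
  mul_nonneg (integral_nonneg fun _ => (Real.exp_pos _).le) (Real.exp_pos _).le

theorem coordLaw_univ_le (φ ψ κ d e r t : ℝ) : coordLaw φ ψ κ d e r t Set.univ ≤ 3 := by
  simp only [coordLaw, Measure.finsetSum_apply, Measure.smul_apply, smul_eq_mul]
  calc _ ≤ ∑ _b : SignType, (1 : ENNReal) := by
        refine Finset.sum_le_sum fun b _ => mul_le_one' ?_ (truncGaussian_univ_le _ _ _)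
        rw [← ENNReal.ofReal_one]
        refine ENNReal.ofReal_le_ofReal (div_le_one_of_le₀ ?_ ?_)
        · exact Finset.single_le_sum (f := compWeight φ ψ κ d e r t)
            (fun b' _ => compWeight_nonneg φ ψ κ d e r t b') (Finset.mem_univ b)
        · exact Finset.sum_nonneg fun b' _ => compWeight_nonneg φ ψ κ d e r t b'
    _ = 3 := by simp [show Fintype.card SignType = 3 from rfl]

instance {p : ℕ} (φ ψ κ : Vec p) (d e : ℝ) : IsFiniteKernel (blockKernel φ ψ κ d e) := by
  refine ⟨⟨3 ^ p, ENNReal.pow_lt_top (by simp), fun q => ?_⟩⟩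
  change blockLaw φ ψ κ d e q Set.univ ≤ 3 ^ p
  rw [blockLaw, Measure.map_apply (WithLp.measurable_toLp 2 _) MeasurableSet.univ,
    Set.preimage_univ, Measure.pi_univ]
  calc _ ≤ ∏ _j : Fin p, (3 : ENNReal) :=
        Finset.prod_le_prod' fun j _ => coordLaw_univ_le _ _ _ _ _ _ _
    _ = 3 ^ p := by simp

/-! ### The chain and its target -/

/-- Transition kernel of the full chain: from `(β, r, t)`, draw the new `β` given the old `(r, t)`,
then the new `(r, t)` given the new `β`. -/
def gibbsKernel {p : ℕ} (M H : Matrix (Fin p) (Fin p) ℝ) (φ ψ κ : Vec p) (d e : ℝ) :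
    Kernel (State p) (State p) :=
  Kernel.prodMkLeft (Vec p)
    (blockKernel φ ψ κ d e ⊗ₖ Kernel.prodMkLeft (Latent p) (latentKernel M H κ d e))

/-- Joint posterior of `(β, r, t)`. -/
def jointPosterior {p : ℕ} (M H : Matrix (Fin p) (Fin p) ℝ) (φ ψ κ : Vec p) (d e : ℝ) :
    Measure (State p) :=
  posterior M H φ ψ κ ⊗ₘ latentKernel M H κ d e

/-- Total variation distance `sup_A |μ(A) - ν(A)|` of two finite measures. -/
def tvDist {α : Type*} [MeasurableSpace α] (μ ν : Measure α) : ℝ :=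
  ⨆ A : {A : Set α // MeasurableSet A}, |μ.real A - ν.real A|

end AntiCorr

end

open AntiCorr

noncomputable section

namespace AntiCorr

/-! ### Total variation distance -/

section TotalVariation

variable {α β : Type*} [MeasurableSpace α] [MeasurableSpace β]

/-! The latent covariances are chosen so that the joint density of `(β, r, t)` factorizes over
coordinates. The law of `(r, t)` given `β` has a Cameron–Martin density against a fixed centred
Gaussian; its quadratic terms in `d I - M` and `e I - H` cancel the `M` and `H` of the posterior,
leaving multiples of `‖θ‖²` and `‖β‖²` and linear terms (`posteriorDensity_mul_latentDensity`). In
one coordinate, completing the square on each of the three ranges of the soft threshold gives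
exactly the stated mixture. So the block update is the conditional law of `β` given `(r, t)`
(`map_swap_jointPosterior`), and invariance follows.

For the rate, `(r, t)` is itself a Markov chain, and Harris' theorem applies to it with `V = ‖r + t‖
/ (d + e)`. Given `(r, t)`, a truncated Gaussian coordinate exceeds the largest relevant mean by a
bounded amount on average, so the mean of `‖β‖` is at most `V` plus a constant. Given `β`, the mean
of `r + t` is, up to a bounded error, `((d + e) I - M - H) β`. Since `d > ‖M‖` and `e > ‖H‖`, its
norm is at most `l (d + e) ‖β‖` with `l < 1`, unless `M` and `H` share a null vector. Properness
excludes that: along such a vector, or its opposite, the posterior density stays bounded below on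
infinitely many disjoint balls. These bounds give the drift. The minorization passes through `β`:
where `V` is bounded, `β` lies in a fixed ball with probability at least one half, and over that
ball the laws of `(r, t)` dominate a common nonzero measure.

Finally, the full chain at time `m + 1` is the image of its `(r, t)`-marginal at time `m` under a
Markov kernel that maps the marginal target to the joint target. Markov kernels do not increase
total variation, so every rate of the marginal is a rate of the full chain. -/

theorem tvDist_le {μ ν : Measure α} {c : ℝ}
    (h : ∀ A, MeasurableSet A → |μ.real A - ν.real A| ≤ c) : tvDist μ ν ≤ c := by
  have : Nonempty {A : Set α // MeasurableSet A} := ⟨⟨∅, .empty⟩⟩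
  exact ciSup_le fun A => h A.1 A.2

theorem abs_measureReal_sub_le_one (μ ν : Measure α) [IsProbabilityMeasure μ]
    [IsProbabilityMeasure ν] (A : Set α) : |μ.real A - ν.real A| ≤ 1 := by
  have h1 : μ.real A ≤ 1 := measureReal_le_one
  have h2 : ν.real A ≤ 1 := measureReal_le_one
  have h3 : 0 ≤ μ.real A := measureReal_nonneg
  have h4 : 0 ≤ ν.real A := measureReal_nonneg
  rw [abs_le]; constructor <;> linarith

theorem tvDist_le_one (μ ν : Measure α) [IsProbabilityMeasure μ] [IsProbabilityMeasure ν] :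
    tvDist μ ν ≤ 1 :=
  tvDist_le fun A _ => abs_measureReal_sub_le_one μ ν A

theorem abs_measureReal_sub_le_tvDist (μ ν : Measure α) [IsProbabilityMeasure μ]
    [IsProbabilityMeasure ν] {A : Set α} (hA : MeasurableSet A) :
    |μ.real A - ν.real A| ≤ tvDist μ ν := by
  refine le_ciSup (f := fun A : {A : Set α // MeasurableSet A} => |μ.real A.1 - ν.real A.1|)
    ⟨1, ?_⟩ ⟨A, hA⟩
  rintro _ ⟨B, rfl⟩
  exact abs_measureReal_sub_le_one μ ν B.1

theorem integrable_of_mem_Icc {μ : Measure α} [IsFiniteMeasure μ] {f : α → ℝ} {a b : ℝ}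
    (hf : Measurable f) (h : ∀ x, f x ∈ Set.Icc a b) : Integrable f μ :=
  Integrable.of_mem_Icc a b hf.aemeasurable (Filter.Eventually.of_forall h)

theorem integral_eq_setIntegral_measureReal_lt {μ : Measure α} [IsProbabilityMeasure μ]
    {f : α → ℝ} (hf : Measurable f) (h : ∀ x, f x ∈ Set.Icc (0 : ℝ) 1) :
    ∫ x, f x ∂μ = ∫ t in Set.Ioc (0 : ℝ) 1, μ.real {x | t < f x} := by
  rw [(integrable_of_mem_Icc hf h).integral_eq_integral_meas_lt
    (Filter.Eventually.of_forall fun x => (h x).1)]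
  refine setIntegral_eq_of_subset_of_forall_sdiff_eq_zero measurableSet_Ioi
    Set.Ioc_subset_Ioi_self ?_
  rintro t ⟨ht, ht'⟩
  have : {x | t < f x} = ∅ := by
    ext x
    simp only [Set.mem_ofPred_eq, Set.mem_empty_iff_false, iff_false, not_lt]
    exact (h x).2.trans (not_le.1 fun h1 => ht' ⟨ht, h1⟩).le
  simp [this]

/-- By the layer-cake formula both integrals average the masses of `{x | t < f x}` over levels `t`
in `(0, 1]`, and at each level the masses differ by at most `tvDist μ ν`. -/
theorem abs_integral_sub_le_tvDist {μ ν : Measure α} [IsProbabilityMeasure μ]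
    [IsProbabilityMeasure ν] {f : α → ℝ} (hf : Measurable f) (h : ∀ x, f x ∈ Set.Icc (0 : ℝ) 1) :
    |∫ x, f x ∂μ - ∫ x, f x ∂ν| ≤ tvDist μ ν := by
  have key : ∀ (μ : Measure α) [IsProbabilityMeasure μ],
      IntegrableOn (fun t => μ.real {x | t < f x}) (Set.Ioc (0 : ℝ) 1) := by
    intro μ _
    have hanti : Antitone fun t : ℝ => μ.real {x | t < f x} := fun s t hst =>
      measureReal_mono fun x hx => lt_of_le_of_lt hst hx
    exact integrable_of_mem_Icc (a := 0) (b := 1) hanti.measurable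
      fun t => ⟨measureReal_nonneg, measureReal_le_one⟩
  rw [integral_eq_setIntegral_measureReal_lt hf h, integral_eq_setIntegral_measureReal_lt hf h,
    ← integral_sub (key μ) (key ν)]
  have := norm_setIntegral_le_of_norm_le_const (μ := (volume : Measure ℝ)) (s := Set.Ioc (0 : ℝ) 1)
    (C := tvDist μ ν) (f := fun t => μ.real {x | t < f x} - ν.real {x | t < f x})
    (by simp) (fun t _ => abs_measureReal_sub_le_tvDist μ ν (measurableSet_lt measurable_const hf))
  simpa using this

theorem measureReal_bind_eq_integral (J : Kernel α β) [IsMarkovKernel J] (μ : Measure α)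
    [IsProbabilityMeasure μ] {A : Set β} (hA : MeasurableSet A) :
    (μ.bind J).real A = ∫ x, (J x).real A ∂μ := by
  rw [measureReal_def, Measure.bind_apply hA J.aemeasurable]
  simp only [measureReal_def]
  rw [integral_toReal (J.measurable_coe hA).aemeasurable
    (Filter.Eventually.of_forall fun x => measure_lt_top _ _)]

theorem integral_bind_kernel (J : Kernel α β) [IsSFiniteKernel J] (μ : Measure α) [SFinite μ]
    {f : β → ℝ} (hf : Integrable f (μ.bind J)) : ∫ y, f y ∂μ.bind J = ∫ x, ∫ y, f y ∂J x ∂μ := by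
  rw [Measure.comp_eq_comp_const_apply] at hf ⊢
  rw [Kernel.integral_comp hf, Kernel.const_apply]

theorem measurable_kernel_real (J : Kernel α β) {A : Set β} (hA : MeasurableSet A) :
    Measurable fun x => (J x).real A :=
  (J.measurable_coe hA).ennreal_toReal

/-- A Markov kernel does not increase the total variation distance. -/
theorem tvDist_bind_le (J : Kernel α β) [IsMarkovKernel J] (μ ν : Measure α)
    [IsProbabilityMeasure μ] [IsProbabilityMeasure ν] :
    tvDist (μ.bind J) (ν.bind J) ≤ tvDist μ ν := by
  refine tvDist_le fun A hA => ?_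
  rw [measureReal_bind_eq_integral J μ hA, measureReal_bind_eq_integral J ν hA]
  exact abs_integral_sub_le_tvDist (measurable_kernel_real J hA)
    fun x => ⟨measureReal_nonneg, measureReal_le_one⟩

end TotalVariation

/-! ### Harris' theorem -/

section Harris

variable {α : Type*} [MeasurableSpace α]

instance isMarkovKernel_pow (P : Kernel α α) [IsMarkovKernel P] (n : ℕ) :
    IsMarkovKernel (P ^ n) := by
  induction n with
  | zero => exact inferInstanceAs (IsMarkovKernel (Kernel.id : Kernel α α))
  | succ n ih => exact inferInstanceAs (IsMarkovKernel ((P ^ n) ∘ₖ P))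

theorem invariant_pow {P : Kernel α α} {π : Measure α} (h : P.Invariant π) (n : ℕ) :
    (P ^ n).Invariant π := by
  induction n with
  | zero => exact Measure.id_comp
  | succ n ih => exact ih.comp h

/-- A drift condition bounds the mean of the Lyapunov function under an invariant law. -/
theorem lintegral_le_of_drift (P : Kernel α α) [IsMarkovKernel P] {π : Measure α}
    [IsProbabilityMeasure π] (hπ : P.Invariant π) {V : α → ℝ} (hV : Measurable V)
    (hV0 : ∀ x, 0 ≤ V x) {l K : ℝ} (hl0 : 0 ≤ l) (hl1 : l < 1) (hK : 0 ≤ K)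
    (hdrift : ∀ x, ∫⁻ y, ENNReal.ofReal (V y) ∂P x ≤ ENNReal.ofReal (l * V x + K)) :
    ∫⁻ x, ENNReal.ofReal (V x) ∂π ≤ ENNReal.ofReal (K / (1 - l)) := by
  have hVi : ∀ x, Integrable V (P x) := fun x =>
    ⟨hV.aestronglyMeasurable, by
      rw [hasFiniteIntegral_iff_ofReal (Filter.Eventually.of_forall hV0)]
      exact (hdrift x).trans_lt ENNReal.ofReal_lt_top⟩
  have hVd : ∀ x, ∫ y, V y ∂P x ≤ l * V x + K := fun x => by
    rw [integral_eq_lintegral_of_nonneg_ae (Filter.Eventually.of_forall hV0)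
      hV.aestronglyMeasurable]
    exact ENNReal.toReal_le_of_le_ofReal (by have := hV0 x; positivity) (hdrift x)
  have h1l : 0 < 1 - l := by linarith
  -- Integrability of `V` under `π` is not yet known, so invariance cannot be applied to `V` itself.
  -- It is applied to `min V n`, with a bound uniform in `n`.
  have trunc : ∀ n : ℕ, ∫⁻ x in {x | V x ≤ n}, ENNReal.ofReal (V x) ∂π
      ≤ ENNReal.ofReal (K / (1 - l)) := by
    intro n
    set W : α → ℝ := fun x => min (V x) n with hW
    have hWm : Measurable W := hV.min measurable_const
    have hWI : ∀ x, W x ∈ Set.Icc (0 : ℝ) n := fun x =>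
      ⟨le_min (hV0 x) (Nat.cast_nonneg n), min_le_right _ _⟩
    have hPW : ∀ x, ∫ y, W y ∂P x ≤ min (l * V x + K) n := fun x => by
      refine le_min ?_ ?_
      · exact (integral_mono (integrable_of_mem_Icc hWm hWI) (hVi x)
          fun y => min_le_left _ _).trans (hVd x)
      · calc _ ≤ ∫ _y, (n : ℝ) ∂P x :=
              integral_mono (integrable_of_mem_Icc hWm hWI) (integrable_const _)
                fun y => min_le_right _ _
          _ = n := by simp
    have hinv : ∫ x, W x ∂π = ∫ x, ∫ y, W y ∂P x ∂π := by
      conv_lhs => rw [← hπ.def]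
      exact integral_bind_kernel P π (by rw [hπ.def]; exact integrable_of_mem_Icc hWm hWI)
    have hS : MeasurableSet {x | V x ≤ n} := measurableSet_le hV measurable_const
    have hmin : ∀ x, min (l * V x + K) n ∈ Set.Icc (0 : ℝ) n := fun x =>
      ⟨le_min (by have := hV0 x; positivity) (Nat.cast_nonneg n), min_le_right _ _⟩
    have hminm : Measurable fun x => min (l * V x + K) n :=
      ((hV.const_mul l).add_const K).min measurable_const
    have h0 : ∫ x, (W x - min (l * V x + K) n) ∂π ≤ 0 := by
      rw [integral_sub (integrable_of_mem_Icc hWm hWI) (integrable_of_mem_Icc hminm hmin), hinv,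
        sub_nonpos]
      refine integral_mono_of_nonneg (Filter.Eventually.of_forall fun x => ?_)
        (integrable_of_mem_Icc hminm hmin) (Filter.Eventually.of_forall hPW)
      exact integral_nonneg fun y => (hWI y).1
    -- The truncated drift gains at least `(1 - l) * V - K` where `V ≤ n`, and loses nothing
    -- elsewhere, both terms being at most `n` there.
    have hind : ∀ x, ({x | V x ≤ n}.indicator fun x => (1 - l) * V x - K) x
        ≤ W x - min (l * V x + K) n := fun x => by
      by_cases hx : V x ≤ n
      · rw [Set.indicator_of_mem (by exact hx)]
        simp only [hW, min_eq_left hx]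
        have := min_le_left (l * V x + K) (n : ℝ)
        linarith
      · rw [Set.indicator_of_notMem (by exact hx)]
        simp only [hW, min_eq_right (not_le.1 hx).le]
        have := min_le_right (l * V x + K) (n : ℝ)
        linarith
    have hVS : IntegrableOn V {x | V x ≤ n} π := by
      refine Integrable.of_mem_Icc 0 n hV.aemeasurable ?_
      filter_upwards [ae_restrict_mem hS] with x hx using ⟨hV0 x, hx⟩
    have h2 : ∫ x in {x | V x ≤ n}, ((1 - l) * V x - K) ∂π ≤ 0 := by
      rw [← integral_indicator hS]
      refine (integral_mono ?_ ?_ hind).trans h0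
      · exact IntegrableOn.integrable_indicator ((hVS.const_mul (1 - l)).sub (integrable_const K)) hS
      · exact (integrable_of_mem_Icc hWm hWI).sub (integrable_of_mem_Icc hminm hmin)
    rw [integral_sub (hVS.const_mul (1 - l)) (integrable_const K), integral_const_mul] at h2
    have h3 : ∫ x in {x | V x ≤ n}, K ∂π ≤ K := by
      rw [setIntegral_const, smul_eq_mul]
      exact mul_le_of_le_one_left hK measureReal_le_one
    rw [← ofReal_integral_eq_lintegral_ofReal hVS (Filter.Eventually.of_forall hV0)]
    refine ENNReal.ofReal_le_ofReal ?_
    rw [le_div_iff₀ h1l]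
    linarith
  have hmono : Monotone fun n : ℕ => {x | V x ≤ n} := fun m n hmn x (hx : V x ≤ m) =>
    hx.trans (by exact_mod_cast hmn)
  have hun : ⋃ n : ℕ, {x | V x ≤ n} = Set.univ := by
    ext x; simpa using exists_nat_ge (V x)
  rw [← setLIntegral_univ, ← hun, setLIntegral_iUnion_of_directed _ hmono.directed_le]
  exact iSup_le trunc

/-- A function with oscillation controlled by a weight is, up to a constant, controlled by it. -/
theorem exists_abs_add_le_of_abs_sub_le {α : Type*} {f w : α → ℝ}
    (h : ∀ x y, |f x - f y| ≤ w x + w y) : ∃ c, ∀ x, |f x + c| ≤ w x := by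
  rcases isEmpty_or_nonempty α with hα | hα
  · exact ⟨0, fun x => hα.elim x⟩
  have hlow : ∀ x y, -(w x) - f x ≤ w y - f y := fun x y => by
    have := (abs_le.1 (h x y)).1
    linarith
  -- The admissible constants at `x` form the interval from `-(w x) - f x` to `w x - f x`. By `hlow`
  -- every lower end is below every upper end, so the infimum of the upper ends lies in all of them.
  refine ⟨⨅ y, (w y - f y), fun x => abs_le.2 ⟨?_, ?_⟩⟩
  · have := le_ciInf (hlow x)
    linarith
  · have := ciInf_le ⟨-(w x) - f x, by rintro _ ⟨y, rfl⟩; exact hlow x y⟩ x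
    linarith

/-- Both `w - g` and `w + g` are nonnegative, so their integrals can only grow from `ν` to `P`. In
effect `|g| ≤ w` is integrated against the positive measure `P - ν`. -/
theorem integral_sub_le_of_minorization {P ν : Measure α} [IsFiniteMeasure P] (hν : ν ≤ P)
    {g w : α → ℝ} (hg : Integrable g P) (hw : Integrable w P) (h : ∀ x, |g x| ≤ w x) :
    |∫ x, g x ∂P - ∫ x, g x ∂ν| ≤ ∫ x, w x ∂P - ∫ x, w x ∂ν := by
  have h1 : ∫ x, (w x - g x) ∂ν ≤ ∫ x, (w x - g x) ∂P :=
    integral_mono_measure hν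
      (Filter.Eventually.of_forall fun x => sub_nonneg.2 (abs_le.1 (h x)).2) (hw.sub hg)
  have h2 : ∫ x, (w x + g x) ∂ν ≤ ∫ x, (w x + g x) ∂P :=
    integral_mono_measure hν
      (Filter.Eventually.of_forall fun x => by have := (abs_le.1 (h x)).1; simp; linarith)
      (hw.add hg)
  have hw' := hw.mono_measure hν
  have hg' := hg.mono_measure hν
  rw [integral_sub hw' hg', integral_sub hw hg] at h1
  rw [integral_add hw' hg', integral_add hw hg] at h2
  rw [abs_le]; constructor <;> linarith

/-- One step of a Markov kernel satisfying a drift and a minorization condition contracts the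
weighted oscillation of functions. -/
theorem exists_contraction_of_drift_of_minorization (P : Kernel α α) [IsMarkovKernel P]
    {V : α → ℝ} (hV : Measurable V) (hV0 : ∀ x, 0 ≤ V x) {l K : ℝ} (hl0 : 0 ≤ l) (hl1 : l < 1)
    (hK : 0 ≤ K) (hdrift : ∀ x, ∫⁻ y, ENNReal.ofReal (V y) ∂P x ≤ ENNReal.ofReal (l * V x + K))
    (hminor : ∀ R : ℝ, ∃ ν : Measure α, IsFiniteMeasure ν ∧ ν Set.univ ≠ 0 ∧ ∀ x, V x ≤ R → ν ≤ P x) :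
    ∃ a b : ℝ, 0 < a ∧ a < 1 ∧ 0 < b ∧ ∀ (t : ℝ) (f : α → ℝ), 0 ≤ t → Measurable f →
      (∃ B, ∀ x, |f x| ≤ B) →
      (∀ x y, |f x - f y| ≤ t * (1 + b * V x) + t * (1 + b * V y)) →
      ∀ x y, |∫ u, f u ∂P x - ∫ u, f u ∂P y|
        ≤ a * t * (1 + b * V x) + a * t * (1 + b * V y) := by
  have hVi : ∀ x, Integrable V (P x) := fun x =>
    ⟨hV.aestronglyMeasurable, by
      rw [hasFiniteIntegral_iff_ofReal (Filter.Eventually.of_forall hV0)]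
      exact (hdrift x).trans_lt ENNReal.ofReal_lt_top⟩
  have hVd : ∀ x, ∫ y, V y ∂P x ≤ l * V x + K := fun x => by
    rw [integral_eq_lintegral_of_nonneg_ae (Filter.Eventually.of_forall hV0)
      hV.aestronglyMeasurable]
    exact ENNReal.toReal_le_of_le_ofReal (by have := hV0 x; positivity) (hdrift x)
  have h1l : 0 < 1 - l := by linarith
  -- The radius satisfies `4 * K ≤ (1 - l) * R`, so for `V x + V y ≥ R` the additive drift `2 * K`
  -- uses at most half of the gain `(1 - l) * (V x + V y)`. The summand `1` makes `R ≥ 1`, which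
  -- lets that gain also pay for the constant part of the weight.
  obtain ⟨ν, hνf, hν0, hν⟩ := hminor (4 * K / (1 - l) + 1)
  set R := 4 * K / (1 - l) + 1 with hR
  have hR1 : 1 ≤ R := by
    have : 0 ≤ 4 * K / (1 - l) := by positivity
    linarith
  have hRK : 4 * K ≤ (1 - l) * R := by
    have : (1 - l) * (4 * K / (1 - l)) = 4 * K := by field_simp
    rw [hR, mul_add, this]; linarith
  obtain ⟨ε, hε0, hε1, hεν⟩ : ∃ ε : ℝ, 0 < ε ∧ ε ≤ 1 ∧ ε ≤ ν.real Set.univ := by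
    refine ⟨min (ν.real Set.univ) 1, lt_min ?_ one_pos, min_le_right _ _, min_le_left _ _⟩
    exact ENNReal.toReal_pos hν0 (measure_ne_top _ _)
  -- The weight of `V` is so small that `2 * b * K ≤ ε`: of the `2 * ε` gained from two minorized
  -- points, at least `ε` survives the drift constant.
  set b : ℝ := ε / (2 * (K + 1)) with hb
  have hb0 : 0 < b := by positivity
  have hbK : 2 * (b * K) ≤ ε := by
    have : b * (2 * (K + 1)) = ε := by rw [hb]; field_simp
    nlinarith
  -- The first two bounds serve the pairs with a point outside the sublevel set, the last two the
  -- pairs inside it.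
  set η : ℝ := min (min (b * (1 - l) / 8) ((1 - l) / 4)) (ε / 2) with hη
  have hη0 : 0 < η := by
    rw [hη]
    exact lt_min (lt_min (by positivity) (by positivity)) (by positivity)
  have hη1 : η ≤ b * (1 - l) / 8 := (min_le_left _ _).trans (min_le_left _ _)
  have hη2 : η ≤ (1 - l) / 4 := (min_le_left _ _).trans (min_le_right _ _)
  have hη3 : η ≤ ε / 2 := min_le_right _ _
  refine ⟨1 - η, b, by linarith, by linarith, hb0, fun t f ht hf ⟨B, hB⟩ h x y => ?_⟩
  -- Adding a constant leaves the difference of the two means unchanged, and turns the bound on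
  -- oscillations into a pointwise bound by the weight.
  obtain ⟨c, hc⟩ := exists_abs_add_le_of_abs_sub_le h
  have hfi : ∀ x, Integrable f (P x) := fun x =>
    integrable_of_mem_Icc hf fun u => abs_le.1 (hB u)
  have hwi : ∀ x, Integrable (fun u => t * (1 + b * V u)) (P x) := fun x =>
    ((integrable_const 1).add ((hVi x).const_mul b)).const_mul t
  have hwd : ∀ x, ∫ u, t * (1 + b * V u) ∂P x ≤ t * (1 + b * (l * V x + K)) := fun x => by
    rw [integral_const_mul, integral_add (integrable_const 1) ((hVi x).const_mul b),
      integral_const_mul]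
    simp only [integral_const, probReal_univ, smul_eq_mul, mul_one]
    gcongr
    exact hVd x
  have hgi : ∀ x, Integrable (fun u => f u + c) (P x) := fun x => (hfi x).add (integrable_const c)
  have hge : ∀ x, ∫ u, f u ∂P x = ∫ u, (f u + c) ∂P x - c := fun x => by
    rw [integral_add (hfi x) (integrable_const c)]; simp
  have hdiff : ∫ u, f u ∂P x - ∫ u, f u ∂P y = ∫ u, (f u + c) ∂P x - ∫ u, (f u + c) ∂P y := by
    rw [hge x, hge y]; ring
  rw [hdiff]
  have hVx := hV0 x
  have hVy := hV0 y
  by_cases hxy : V x ≤ R ∧ V y ≤ R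
  -- Both points are minorized: each mean is compared with the integral against `ν`, and the weight,
  -- being at least `t`, loses at least `t * ε` each time.
  · have hone : ∀ z, V z ≤ R → |∫ u, (f u + c) ∂P z - ∫ u, (f u + c) ∂ν|
        ≤ t * (1 + b * (l * V z + K) - ε) := fun z hz => by
      refine (integral_sub_le_of_minorization (hν z hz) (hgi z) (hwi z) hc).trans ?_
      have : t * ε ≤ ∫ u, t * (1 + b * V u) ∂ν := by
        calc t * ε ≤ t * ν.real Set.univ := by gcongr
          _ = ∫ _u, t * 1 ∂ν := by rw [integral_const, smul_eq_mul]; ring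
          _ ≤ _ := by
            refine integral_mono (integrable_const _) ((hwi z).mono_measure (hν z hz)) fun u => ?_
            have := mul_nonneg hb0.le (hV0 u)
            exact mul_le_mul_of_nonneg_left (by linarith) ht
      have := hwd z
      linarith
    calc |∫ u, (f u + c) ∂P x - ∫ u, (f u + c) ∂P y|
        ≤ |∫ u, (f u + c) ∂P x - ∫ u, (f u + c) ∂ν|
          + |∫ u, (f u + c) ∂ν - ∫ u, (f u + c) ∂P y| := abs_sub_le _ _ _
      _ ≤ t * (1 + b * (l * V x + K) - ε) + t * (1 + b * (l * V y + K) - ε) := by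
        rw [abs_sub_comm (∫ u, (f u + c) ∂ν)]
        exact add_le_add (hone x hxy.1) (hone y hxy.2)
      _ = t * (2 + b * l * (V x + V y) + 2 * (b * K) - 2 * ε) := by ring
      _ ≤ t * ((1 - η) * (2 + b * (V x + V y))) := by
        refine mul_le_mul_of_nonneg_left ?_ ht
        have : 0 ≤ b * (V x + V y) * (1 - η - l) :=
          mul_nonneg (by positivity) (by linarith)
        nlinarith
      _ = _ := by ring
  -- Here one value of `V` exceeds `R`, and the drift alone contracts: no cancellation between the
  -- two means is needed.
  · have hS : R ≤ V x + V y := by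
      by_contra hlt
      exact hxy ⟨by linarith, by linarith⟩
    have hone : ∀ z, |∫ u, (f u + c) ∂P z| ≤ t * (1 + b * (l * V z + K)) := fun z =>
      (abs_integral_le_integral_abs.trans (integral_mono (hgi z).abs (hwi z) hc)).trans (hwd z)
    calc |∫ u, (f u + c) ∂P x - ∫ u, (f u + c) ∂P y|
        ≤ |∫ u, (f u + c) ∂P x| + |∫ u, (f u + c) ∂P y| := abs_sub _ _
      _ ≤ t * (1 + b * (l * V x + K)) + t * (1 + b * (l * V y + K)) :=
        add_le_add (hone x) (hone y)
      _ = t * (2 + b * l * (V x + V y) + b * (2 * K)) := by ring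
      _ ≤ t * ((1 - η) * (2 + b * (V x + V y))) := by
        refine mul_le_mul_of_nonneg_left ?_ ht
        have h1 : b * (2 * K) ≤ b * ((1 - l) / 2 * (V x + V y)) := by
          refine mul_le_mul_of_nonneg_left ?_ hb0.le
          nlinarith
        have h2 : b * 1 ≤ b * (V x + V y) := mul_le_mul_of_nonneg_left (by linarith) hb0.le
        have h3 : 0 ≤ b * (V x + V y) * ((1 - l) / 4 - η) :=
          mul_nonneg (by positivity) (by linarith)
        nlinarith
      _ = _ := by ring

/-- The contraction is iterated on `y ↦ ((P ^ n) y).real A` with `t = a ^ n`. At `n = 0` this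
function takes values in `[0, 1]`, so `t = 1` will do. -/
theorem abs_pow_real_sub_le (P : Kernel α α) [IsMarkovKernel P] {V : α → ℝ} (hV0 : ∀ x, 0 ≤ V x)
    {a b : ℝ} (ha : 0 < a) (hb : 0 < b)
    (h : ∀ (t : ℝ) (f : α → ℝ), 0 ≤ t → Measurable f → (∃ B, ∀ x, |f x| ≤ B) →
      (∀ x y, |f x - f y| ≤ t * (1 + b * V x) + t * (1 + b * V y)) →
      ∀ x y, |∫ u, f u ∂P x - ∫ u, f u ∂P y|
        ≤ a * t * (1 + b * V x) + a * t * (1 + b * V y))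
    {A : Set α} (hA : MeasurableSet A) (n : ℕ) (x y : α) :
    |((P ^ n) x).real A - ((P ^ n) y).real A|
      ≤ a ^ n * (1 + b * V x) + a ^ n * (1 + b * V y) := by
  induction n generalizing x y with
  | zero =>
    refine (abs_measureReal_sub_le_one _ _ A).trans ?_
    have := mul_nonneg hb.le (hV0 x)
    have := mul_nonneg hb.le (hV0 y)
    rw [pow_zero]; linarith
  | succ n ih =>
    have hrec : ∀ x, ((P ^ (n + 1)) x).real A = ∫ y, ((P ^ n) y).real A ∂P x := fun x =>
      measureReal_bind_eq_integral (P ^ n) (P x) hA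
    rw [hrec, hrec, pow_succ' a]
    refine h (a ^ n) _ (by positivity) (measurable_kernel_real _ hA) ⟨1, fun x => ?_⟩ ih x y
    rw [abs_of_nonneg measureReal_nonneg]
    exact measureReal_le_one

/-- **Harris' theorem**: a Markov kernel with a geometric drift towards the sublevel sets of a
Lyapunov function, on which it is minorized, converges geometrically to its invariant law. -/
theorem exists_tvDist_pow_le_of_drift_of_minorization (P : Kernel α α) [IsMarkovKernel P]
    {π : Measure α} [IsProbabilityMeasure π] (hπ : P.Invariant π) {V : α → ℝ} (hV : Measurable V)
    (hV0 : ∀ x, 0 ≤ V x) {l K : ℝ} (hl0 : 0 ≤ l) (hl1 : l < 1) (hK : 0 ≤ K)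
    (hdrift : ∀ x, ∫⁻ y, ENNReal.ofReal (V y) ∂P x ≤ ENNReal.ofReal (l * V x + K))
    (hminor : ∀ R : ℝ, ∃ ν : Measure α,
      IsFiniteMeasure ν ∧ ν Set.univ ≠ 0 ∧ ∀ x, V x ≤ R → ν ≤ P x) :
    ∃ γ : ℝ, 0 < γ ∧ γ < 1 ∧ ∃ C : α → ℝ, ∀ (m : ℕ) (x : α),
      tvDist ((P ^ m) x) π ≤ C x * γ ^ m := by
  obtain ⟨a, b, ha0, ha1, hb, h⟩ :=
    exists_contraction_of_drift_of_minorization P hV hV0 hl0 hl1 hK hdrift hminor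
  have hVπ : Integrable V π := ⟨hV.aestronglyMeasurable, by
    rw [hasFiniteIntegral_iff_ofReal (Filter.Eventually.of_forall hV0)]
    exact (lintegral_le_of_drift P hπ hV hV0 hl0 hl1 hK hdrift).trans_lt ENNReal.ofReal_lt_top⟩
  refine ⟨a, ha0, ha1, fun x => (1 + b * V x) + (1 + b * ∫ y, V y ∂π), fun m x => ?_⟩
  refine tvDist_le fun A hA => ?_
  have hint : Integrable (fun y => ((P ^ m) y).real A) π :=
    integrable_of_mem_Icc (measurable_kernel_real _ hA)
      fun y => ⟨measureReal_nonneg, measureReal_le_one⟩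
  have hwi : Integrable (fun y => 1 + b * V y) π := (integrable_const 1).add (hVπ.const_mul b)
  -- Invariance writes `π` as the average of the chain's laws over starting points drawn from `π`,
  -- so the distance to `π` is an average of distances between two starting points. It is finite
  -- because `V` is integrable under `π`.
  have hπA : π.real A = ∫ y, ((P ^ m) y).real A ∂π := by
    conv_lhs => rw [← (invariant_pow hπ m).def]
    exact measureReal_bind_eq_integral _ _ hA
  have hconst : ((P ^ m) x).real A = ∫ _y, ((P ^ m) x).real A ∂π := by simp
  rw [hπA, hconst, ← integral_sub (integrable_const _) hint]
  calc |∫ y, (((P ^ m) x).real A - ((P ^ m) y).real A) ∂π|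
      ≤ ∫ y, |((P ^ m) x).real A - ((P ^ m) y).real A| ∂π := abs_integral_le_integral_abs
    _ ≤ ∫ y, (a ^ m * (1 + b * V x) + a ^ m * (1 + b * V y)) ∂π :=
      integral_mono ((integrable_const _).sub hint).abs
        ((integrable_const _).add (hwi.const_mul _))
        fun y => abs_pow_real_sub_le P hV0 ha0 hb h hA m x y
    _ = _ := by
      rw [integral_add (integrable_const _) (hwi.const_mul _), integral_const,
        integral_const_mul (a ^ m), integral_add (integrable_const 1) (hVπ.const_mul b), integral_const_mul]
      simp only [integral_const, probReal_univ, smul_eq_mul]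
      ring

end Harris

/-! ### Two-block Gibbs samplers -/

section TwoBlock

variable {X Y : Type*} [MeasurableSpace X] [MeasurableSpace Y]

theorem bind_prodMkLeft {Z : Type*} [MeasurableSpace Z] (μ : Measure (X × Y)) (J : Kernel Y Z) :
    μ.bind (Kernel.prodMkLeft X J) = (μ.map Prod.snd).bind J := by
  ext A hA
  rw [Measure.bind_apply hA (Kernel.aemeasurable _), Measure.bind_apply hA (Kernel.aemeasurable _),
    lintegral_map (J.measurable_coe hA) measurable_snd]
  rfl

theorem pow_succ_prodMkLeft_apply (J : Kernel Y (X × Y)) (m : ℕ) (x : X) (y : Y) :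
    ((Kernel.prodMkLeft X J) ^ (m + 1)) (x, y)
      = ((((Kernel.prodMkLeft X J) ^ m) (x, y)).map Prod.snd).bind J := by
  rw [← bind_prodMkLeft, pow_succ']
  rfl

variable (K : Kernel X Y) [IsMarkovKernel K] (L : Kernel Y X) [IsMarkovKernel L]

/-- The second block of a two-block Gibbs sampler is itself a Markov chain. -/
theorem map_snd_pow_gibbs (m : ℕ) (x : X) (y : Y) :
    ((Kernel.prodMkLeft X (L ⊗ₖ Kernel.prodMkLeft Y K) ^ m) (x, y)).map Prod.snd
      = ((K ∘ₖ L) ^ m) y := by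
  induction m with
  | zero =>
    change (Kernel.id (x, y)).map Prod.snd = Kernel.id y
    rw [Kernel.id_apply, Kernel.id_apply, Measure.map_dirac' measurable_snd]
  | succ m ih =>
    rw [pow_succ_prodMkLeft_apply, ih, pow_succ' (K ∘ₖ L), Kernel.comp_eq_snd_compProd,
      Measure.map_comp _ _ measurable_snd, ← Kernel.snd_eq]
    rfl

theorem bind_compProd_prodMkLeft (μ : Measure Y) [SFinite μ] :
    μ.bind (L ⊗ₖ Kernel.prodMkLeft Y K) = (μ.bind L) ⊗ₘ K := by
  ext A hA
  rw [Measure.bind_apply hA (Kernel.aemeasurable _), Measure.compProd_apply hA,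
    Measure.lintegral_bind L.aemeasurable
      (Kernel.measurable_kernel_prodMk_left hA).aemeasurable]
  refine lintegral_congr fun y => ?_
  rw [Kernel.compProd_apply hA]
  rfl

/-- A two-block Gibbs sampler started at the marginal law of the second block reaches the
target in one step. -/
theorem bind_snd_of_swap {π : Measure X} [IsProbabilityMeasure π]
    (h : (π ⊗ₘ K).map Prod.swap = (π.bind K) ⊗ₘ L) :
    ((π ⊗ₘ K).map Prod.snd).bind (L ⊗ₖ Kernel.prodMkLeft Y K) = π ⊗ₘ K := by
  have hs : (π ⊗ₘ K).map Prod.snd = π.bind K := Measure.snd_compProd π K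
  -- The first marginal of the joint law is `π`; read through the swapped disintegration `h`, it is
  -- `(π.bind K).bind L`.
  have hL : (π.bind K).bind L = π := by
    rw [← Measure.snd_compProd, ← h, Measure.snd, Measure.map_map measurable_snd measurable_swap]
    exact Measure.fst_compProd π K
  rw [hs, bind_compProd_prodMkLeft, hL]

theorem invariant_gibbs_of_swap {π : Measure X} [IsProbabilityMeasure π]
    (h : (π ⊗ₘ K).map Prod.swap = (π.bind K) ⊗ₘ L) :
    (Kernel.prodMkLeft X (L ⊗ₖ Kernel.prodMkLeft Y K)).Invariant (π ⊗ₘ K) := by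
  rw [Kernel.Invariant, bind_prodMkLeft, bind_snd_of_swap K L h]

theorem invariant_comp_of_swap {π : Measure X} [IsProbabilityMeasure π]
    (h : (π ⊗ₘ K).map Prod.swap = (π.bind K) ⊗ₘ L) :
    (K ∘ₖ L).Invariant ((π ⊗ₘ K).map Prod.snd) := by
  have hs : (π ⊗ₘ K).map Prod.snd = π.bind K := Measure.snd_compProd π K
  have hL : (π.bind K).bind L = π := by
    rw [← Measure.snd_compProd, ← h, Measure.snd, Measure.map_map measurable_snd measurable_swap]
    exact Measure.fst_compProd π K
  rw [hs, Kernel.Invariant, ← Measure.comp_assoc, hL]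

/-- The full two-block Gibbs sampler inherits every geometric rate of its second block. -/
theorem exists_tvDist_pow_gibbs_le {π : Measure X} [IsProbabilityMeasure π]
    (h : (π ⊗ₘ K).map Prod.swap = (π.bind K) ⊗ₘ L) {γ : ℝ} (hγ0 : 0 < γ)
    {C : Y → ℝ} (hC : ∀ (m : ℕ) (x : X) (y : Y),
      tvDist (((Kernel.prodMkLeft X (L ⊗ₖ Kernel.prodMkLeft Y K) ^ m) (x, y)).map Prod.snd)
        ((π ⊗ₘ K).map Prod.snd) ≤ C y * γ ^ m) :
    ∃ C' : Y → ℝ, ∀ (m : ℕ) (x : X) (y : Y),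
      tvDist ((Kernel.prodMkLeft X (L ⊗ₖ Kernel.prodMkLeft Y K) ^ m) (x, y)) (π ⊗ₘ K)
        ≤ C' y * γ ^ m := by
  -- The summand `1` covers `m = 0`. The division by `γ` pays for the lag: the full law at time `m +
  -- 1` is controlled by the marginal at time `m`.
  refine ⟨fun y => 1 + |C y| / γ, fun m x y => ?_⟩
  cases m with
  | zero =>
    refine (tvDist_le_one _ _).trans ?_
    have : 0 ≤ |C y| / γ := by positivity
    rw [pow_zero]; linarith
  | succ m =>
    have h1 : IsProbabilityMeasure
        (((Kernel.prodMkLeft X (L ⊗ₖ Kernel.prodMkLeft Y K) ^ m) (x, y)).map Prod.snd) :=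
      Measure.isProbabilityMeasure_map measurable_snd.aemeasurable
    have h2 : IsProbabilityMeasure ((π ⊗ₘ K).map Prod.snd) :=
      Measure.isProbabilityMeasure_map measurable_snd.aemeasurable
    have h3 := tvDist_bind_le (L ⊗ₖ Kernel.prodMkLeft Y K)
      (((Kernel.prodMkLeft X (L ⊗ₖ Kernel.prodMkLeft Y K) ^ m) (x, y)).map Prod.snd)
      ((π ⊗ₘ K).map Prod.snd)
    rw [bind_snd_of_swap K L h, ← pow_succ_prodMkLeft_apply] at h3
    refine (h3.trans (hC m x y)).trans ?_
    have h4 : C y * γ ^ m ≤ |C y| / γ * γ ^ (m + 1) := by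
      rw [pow_succ, mul_comm (γ ^ m), ← mul_assoc, div_mul_cancel₀ _ hγ0.ne']
      exact mul_le_mul_of_nonneg_right (le_abs_self _) (by positivity)
    have h5 : 0 < γ ^ (m + 1) := by positivity
    rw [add_mul]; linarith

end TwoBlock

/-! ### Bayes' formula for densities -/

section Bayes

variable {X Y : Type*} [MeasurableSpace X] [MeasurableSpace Y]

/-- Integrating out `x` gives the second marginal the density `∫⁻ x, F (x, y) ∂lam`, and `hL` says
that this factor times `L y` restores `F`. Bayes' formula in this multiplied form needs no division
by a normalizing integral that might be zero or infinite. -/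
theorem map_swap_compProd_eq_of_density (π lam : Measure X) [SFinite π] [SFinite lam]
    (ρ : Measure Y) [SFinite ρ] (K : Kernel X Y) [IsMarkovKernel K] (L : Kernel Y X)
    [IsMarkovKernel L] {F : X × Y → ENNReal} (hF : Measurable F) (c : ENNReal)
    (hK : π ⊗ₘ K = c • (lam.prod ρ).withDensity F)
    (hL : ∀ y, lam.withDensity (fun x => F (x, y)) = (∫⁻ x, F (x, y) ∂lam) • L y) :
    (π ⊗ₘ K).map Prod.swap = (π.bind K) ⊗ₘ L := by
  have hsnd : π.bind K = c • ρ.withDensity fun y => ∫⁻ x, F (x, y) ∂lam := by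
    rw [← Measure.snd_compProd, hK]
    ext A hA
    rw [Measure.snd_apply hA, Measure.smul_apply, Measure.smul_apply,
      withDensity_apply _ (measurable_snd hA), withDensity_apply _ hA,
      ← lintegral_indicator (measurable_snd hA), lintegral_prod_symm' _
        (hF.indicator (measurable_snd hA)), ← lintegral_indicator hA]
    congr 1
    refine lintegral_congr fun y => ?_
    by_cases hy : y ∈ A
    · rw [Set.indicator_of_mem hy]
      exact lintegral_congr fun x => Set.indicator_of_mem (by exact hy) _
    · rw [Set.indicator_of_notMem hy]
      simp only [Set.indicator_of_notMem (s := Prod.snd ⁻¹' A) (a := (_, y)) (by exact hy),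
        lintegral_zero]
  have hFi : Measurable fun y => ∫⁻ x, F (x, y) ∂lam := hF.lintegral_prod_left'
  ext A hA
  have hA' : MeasurableSet (Prod.swap ⁻¹' A : Set (X × Y)) := measurable_swap hA
  rw [Measure.map_apply measurable_swap hA, hK, Measure.smul_apply, withDensity_apply _ hA',
    ← lintegral_indicator hA', lintegral_prod_symm' _ (hF.indicator hA'),
    Measure.compProd_apply hA, hsnd, lintegral_smul_measure,
    lintegral_withDensity_eq_lintegral_mul _ hFi (Kernel.measurable_kernel_prodMk_left hA)]
  congr 1
  refine lintegral_congr fun y => ?_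
  have hAy : MeasurableSet (Prod.mk y ⁻¹' A) := measurable_prodMk_left hA
  have := congrArg (fun μ : Measure X => μ (Prod.mk y ⁻¹' A)) (hL y)
  simp only [Measure.smul_apply, smul_eq_mul] at this
  rw [Pi.mul_apply, ← this, withDensity_apply _ hAy, ← lintegral_indicator hAy]
  rfl

end Bayes

/-! ### Densities of finite products -/

theorem lintegral_pi_prod_eq_prod {n : ℕ} (μ : Fin n → Measure ℝ) [∀ i, SigmaFinite (μ i)]
    {f : Fin n → ℝ → ENNReal} (hf : ∀ i, Measurable (f i)) :
    ∫⁻ x, ∏ i, f i (x i) ∂Measure.pi μ = ∏ i, ∫⁻ x, f i x ∂μ i := by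
  induction n with
  | zero => simp
  | succ n ih =>
    have hm : Measurable fun x : Fin n → ℝ => ∏ i : Fin n, f i.succ (x i) :=
      Finset.measurable_prod _ fun i _ => (hf i.succ).comp (measurable_pi_apply i)
    calc ∫⁻ x, ∏ i, f i (x i) ∂Measure.pi μ
        = ∫⁻ x : ℝ × (Fin n → ℝ), f 0 x.1 * ∏ i : Fin n, f i.succ (x.2 i)
            ∂((μ 0).prod (Measure.pi fun i => μ i.succ)) := by
          rw [← (measurePreserving_piFinSuccAbove μ 0).symm.lintegral_comp_emb
            (MeasurableEquiv.measurableEmbedding _)]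
          simp_rw [MeasurableEquiv.piFinSuccAbove_symm_apply, Fin.insertNthEquiv,
            Fin.prod_univ_succ, Fin.insertNth_zero, Equiv.coe_fn_mk, Fin.cons_succ,
            Fin.zero_succAbove, cast_eq, Fin.cons_zero]
      _ = (∫⁻ x, f 0 x ∂μ 0) * ∏ i : Fin n, ∫⁻ x, f i.succ x ∂μ i.succ := by
          rw [lintegral_prod_mul (hf 0).aemeasurable hm.aemeasurable,
            ih (fun i => μ i.succ) fun i => hf i.succ]
      _ = _ := (Fin.prod_univ_succ fun i => ∫⁻ x, f i x ∂μ i).symm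

theorem pi_withDensity_eq {n : ℕ} (μ : Fin n → Measure ℝ) [∀ i, SigmaFinite (μ i)]
    {f : Fin n → ℝ → ENNReal} (hf : ∀ i, Measurable (f i))
    [∀ i, SigmaFinite ((μ i).withDensity (f i))] :
    Measure.pi (fun i => (μ i).withDensity (f i))
      = (Measure.pi μ).withDensity fun x => ∏ i, f i (x i) := by
  refine Measure.pi_eq fun s hs => ?_
  rw [withDensity_apply _ (MeasurableSet.univ_pi hs), Measure.restrict_pi_pi,
    lintegral_pi_prod_eq_prod _ hf]
  exact Finset.prod_congr rfl fun i _ => (withDensity_apply _ (hs i)).symm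

theorem map_withDensity_comp {α β : Type*} [MeasurableSpace α] [MeasurableSpace β] {T : α → β}
    (hT : Measurable T) (μ : Measure α) {f : β → ENNReal} (hf : Measurable f) :
    (μ.withDensity (f ∘ T)).map T = (μ.map T).withDensity f := by
  ext A hA
  rw [Measure.map_apply hT hA, withDensity_apply _ (hT hA), withDensity_apply _ hA,
    setLIntegral_map hA hf hT]
  rfl

/-! ### Shifted Gaussian measures -/

theorem gaussianReal_one_eq_withDensity (h : ℝ) :
    gaussianReal h 1
      = (gaussianReal 0 1).withDensity fun x => ENNReal.ofReal (Real.exp (x * h - h ^ 2 / 2)) := by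
  rw [gaussianReal_of_var_ne_zero _ one_ne_zero, gaussianReal_of_var_ne_zero _ one_ne_zero,
    ← withDensity_mul _ (measurable_gaussianPDF 0 1) (by fun_prop)]
  congr 1
  ext x
  rw [Pi.mul_apply, gaussianPDF, gaussianPDF, ← ENNReal.ofReal_mul (gaussianPDFReal_nonneg _ _ _)]
  congr 1
  rw [gaussianPDFReal, gaussianPDFReal, mul_assoc _ (Real.exp _), ← Real.exp_add]
  congr 2
  simp only [NNReal.coe_one]
  ring

variable {p : ℕ}

/-- The **Cameron–Martin formula** for the standard Gaussian measure. -/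
theorem stdGaussian_map_add (h : Vec p) :
    (stdGaussian (Vec p)).map (fun x => h + x)
      = (stdGaussian (Vec p)).withDensity
          fun x => ENNReal.ofReal (Real.exp (inner ℝ x h - inner ℝ h h / 2)) := by
  rw [← map_pi_eq_stdGaussian, ← map_withDensity_comp (WithLp.measurable_toLp 2 _) _ (by fun_prop),
    Measure.map_map (by fun_prop) (WithLp.measurable_toLp 2 _)]
  have h1 : (fun x : Vec p => h + x) ∘ (WithLp.toLp 2 : (Fin p → ℝ) → Vec p)
      = WithLp.toLp 2 ∘ fun x j => h j + x j := by
    ext x j; simp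
  rw [h1, ← Measure.map_map (WithLp.measurable_toLp 2 _) (by fun_prop),
    Measure.pi_map_pi fun _ => by fun_prop]
  simp_rw [gaussianReal_map_const_add, zero_add]
  have h2 : (fun j => gaussianReal (h j) 1) = fun j => (gaussianReal 0 1).withDensity
      fun x => ENNReal.ofReal (Real.exp (x * h j - h j ^ 2 / 2)) :=
    funext fun j => gaussianReal_one_eq_withDensity (h j)
  have h3 : ∀ j, IsProbabilityMeasure ((gaussianReal 0 1).withDensity
      fun x => ENNReal.ofReal (Real.exp (x * h j - h j ^ 2 / 2))) := fun j => by
    rw [← gaussianReal_one_eq_withDensity]; infer_instance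
  rw [h2, pi_withDensity_eq _ fun j => by fun_prop]
  congr 2
  ext x
  rw [Function.comp_apply, ← ENNReal.ofReal_prod_of_nonneg fun _ _ => (Real.exp_pos _).le,
    ← Real.exp_sum, Finset.sum_sub_distrib]
  congr 3
  · simp [PiLp.inner_apply, mul_comm]
  · rw [PiLp.inner_apply, Finset.sum_div]
    simp [pow_two]

theorem matMap_mul_apply (A B : Matrix (Fin p) (Fin p) ℝ) (x : Vec p) :
    matMap (A * B) x = matMap A (matMap B x) := by
  rw [matMap, map_mul]; rfl

theorem inner_matMap_comm {A : Matrix (Fin p) (Fin p) ℝ} (hA : A.IsHermitian) (x y : Vec p) :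
    inner ℝ (matMap A x) y = inner ℝ x (matMap A y) := by
  have h : IsSelfAdjoint (matMap A) := IsSelfAdjoint.map hA _
  exact (ContinuousLinearMap.isSelfAdjoint_iff_isSymmetric.1 h) x y

open scoped MatrixOrder in
/-- The **Cameron–Martin formula** for a possibly degenerate Gaussian measure shifted along the
range of its covariance. -/
theorem multivariateGaussian_matMap_eq {S : Matrix (Fin p) (Fin p) ℝ} (hS : S.PosSemidef)
    (x : Vec p) :
    multivariateGaussian (matMap S x) S
      = (multivariateGaussian 0 S).withDensity
          fun y => ENNReal.ofReal (Real.exp (inner ℝ y x - inner ℝ x (matMap S x) / 2)) := by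
  set Q := CFC.sqrt S with hQ
  have hQQ : Q * Q = S := CFC.sqrt_mul_sqrt_self S hS.nonneg
  have hQs : Q.IsHermitian := (CFC.sqrt_nonneg S).isSelfAdjoint
  -- Since `S x = Q (Q x)`, the shift comes from shifting the standard Gaussian by `Q x` before
  -- applying `Q`. The density there depends on `z` only through `Q z`, so it descends to the image
  -- and `S` need not be invertible.
  have hm : multivariateGaussian (matMap S x) S
      = ((stdGaussian (Vec p)).map fun z => matMap Q x + z).map (matMap Q) := by
    rw [Measure.map_map (by fun_prop) (by fun_prop), multivariateGaussian]
    congr 1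
    ext1 z
    rw [Function.comp_apply, map_add, ← matMap_mul_apply, hQQ]
  have h0 : multivariateGaussian 0 S = (stdGaussian (Vec p)).map (matMap Q) := by
    rw [multivariateGaussian]; simp [hQ]
  rw [hm, h0, stdGaussian_map_add, ← map_withDensity_comp (by fun_prop) _ (by fun_prop)]
  congr 2
  ext z
  rw [Function.comp_apply, inner_matMap_comm hQs, inner_matMap_comm hQs, ← matMap_mul_apply, hQQ]

theorem lintegral_norm_multivariateGaussian_lt_top (S : Matrix (Fin p) (Fin p) ℝ) :
    ∫⁻ y, ENNReal.ofReal ‖y‖ ∂multivariateGaussian (0 : Vec p) S < ⊤ := by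
  have h : Integrable id (multivariateGaussian (0 : Vec p) S) := IsGaussian.integrable_id
  have := h.norm.lintegral_lt_top
  exact this

theorem multivariateGaussian_eq_map_add (m : Vec p) (S : Matrix (Fin p) (Fin p) ℝ) :
    multivariateGaussian m S = (multivariateGaussian 0 S).map fun y => m + y := by
  rw [multivariateGaussian, multivariateGaussian, Measure.map_map (by fun_prop) (by fun_prop)]
  congr 1
  ext1 z
  simp

/-! ### The one-dimensional mixture as a measure with density -/

/-- Unnormalized conditional density of one coordinate of `β` given `(r, t)`. -/
def coordDensity (φ ψ κ d e r t x : ℝ) : ℝ :=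
  Real.exp (-(d / 2) * (Real.sign x * max (|x| - κ) 0) ^ 2
    + (φ + r) * (Real.sign x * max (|x| - κ) 0) - e / 2 * x ^ 2 + (ψ + t) * x)

theorem measurable_sign : Measurable Real.sign :=
  Measurable.ite measurableSet_Iio measurable_const
    (Measurable.ite measurableSet_Ioi measurable_const measurable_const)

theorem measurable_coordDensity (φ ψ κ d e r t : ℝ) :
    Measurable (coordDensity φ ψ κ d e r t) := by
  have h : Measurable fun x : ℝ => Real.sign x * max (|x| - κ) 0 :=
    measurable_sign.mul ((continuous_abs.measurable.sub_const κ).max measurable_const)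
  unfold coordDensity
  fun_prop

/-- On each range the soft threshold is affine (`0`, `x - κ` or `x + κ`), so the log density is a
quadratic. Completing the square yields the mean, the precision and the exponent of the component.
-/
theorem exp_compExponent_mul_exp {φ ψ κ d e r t x : ℝ} (hκ : 0 ≤ κ) (hd : 0 < d) (he : 0 < e)
    {b : SignType} (hx : x ∈ compSupport κ b) :
    Real.exp (compExponent φ ψ κ d e r t b) *
        Real.exp (-(compPrec d e b / 2) * (x - compMean φ ψ κ d e r t b) ^ 2)
      = coordDensity φ ψ κ d e r t x := by
  have hde : d + e ≠ 0 := by positivity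
  rw [coordDensity, ← Real.exp_add]
  congr 1
  cases b with
  | zero =>
    have h1 : max (|x| - κ) 0 = 0 := max_eq_right (by
      have := abs_lt.2 hx; linarith)
    simp only [compExponent, compPrec, compMean, h1]
    field_simp
    ring
  | pos =>
    have hx' : κ < x := hx
    have hx0 : 0 < x := hκ.trans_lt hx'
    have h1 : max (|x| - κ) 0 = x - κ := by
      rw [abs_of_pos hx0]; exact max_eq_left (by linarith)
    simp only [compExponent, compPrec, compMean, h1, Real.sign_of_pos hx0]
    field_simp
    ring
  | neg =>
    have hx' : x < -κ := hx
    have hx0 : x < 0 := by linarith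
    have h1 : max (|x| - κ) 0 = -x - κ := by
      rw [abs_of_neg hx0]; exact max_eq_left (by linarith)
    simp only [compExponent, compPrec, compMean, h1, Real.sign_of_neg hx0]
    field_simp
    ring

theorem integrable_exp_neg_mul_sub_sq {τ : ℝ} (hτ : 0 < τ) (a : ℝ) :
    Integrable fun x : ℝ => Real.exp (-(τ / 2) * (x - a) ^ 2) :=
  (integrable_exp_neg_mul_sq (half_pos hτ)).comp_sub_right a

theorem compPrec_pos {d e : ℝ} (hd : 0 < d) (he : 0 < e) (b : SignType) : 0 < compPrec d e b := by
  cases b <;> simp only [compPrec] <;> positivity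

theorem truncMass_nonneg (a τ : ℝ) (s : Set ℝ) : 0 ≤ truncMass a τ s :=
  integral_nonneg fun _ => (Real.exp_pos _).le

theorem truncMass_pos {τ : ℝ} (hτ : 0 < τ) (a : ℝ) {s : Set ℝ} (hs : volume s ≠ 0) :
    0 < truncMass a τ s := by
  rw [truncMass, integral_pos_iff_support_of_nonneg_ae
    (Filter.Eventually.of_forall fun _ => (Real.exp_pos _).le)
    (integrable_exp_neg_mul_sub_sq hτ a).integrableOn]
  have : Function.support (fun x : ℝ => Real.exp (-(τ / 2) * (x - a) ^ 2)) = Set.univ :=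
    Set.eq_univ_of_forall fun x => (Real.exp_pos _).ne'
  rw [this, Measure.restrict_apply_univ]
  exact pos_iff_ne_zero.2 hs

section Coord

variable {φ ψ κ d e r t : ℝ}

theorem setLIntegral_coordDensity (hκ : 0 ≤ κ) (hd : 0 < d) (he : 0 < e) (b : SignType) :
    ∫⁻ x in compSupport κ b, ENNReal.ofReal (coordDensity φ ψ κ d e r t x)
      = ENNReal.ofReal (compWeight φ ψ κ d e r t b) := by
  rw [setLIntegral_congr_fun (measurableSet_compSupport κ b) (g := fun x =>
      ENNReal.ofReal (Real.exp (compExponent φ ψ κ d e r t b) *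
        Real.exp (-(compPrec d e b / 2) * (x - compMean φ ψ κ d e r t b) ^ 2)))
      fun x hx => by simp only [exp_compExponent_mul_exp hκ hd he hx],
    ← ofReal_integral_eq_lintegral_ofReal
      ((integrable_exp_neg_mul_sub_sq (compPrec_pos hd he b) _).integrableOn.const_mul _)
      (Filter.Eventually.of_forall fun x => by positivity),
    integral_const_mul, compWeight, truncMass, mul_comm]

theorem sum_compWeight_pos (hd : 0 < d) (he : 0 < e) :
    0 < ∑ b : SignType, compWeight φ ψ κ d e r t b := by
  refine Finset.sum_pos' (fun b _ => compWeight_nonneg _ _ _ _ _ _ _ b)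
    ⟨.pos, Finset.mem_univ _, mul_pos (truncMass_pos (compPrec_pos hd he _) _ ?_) (Real.exp_pos _)⟩
  simp [compSupport]

/-- The truncation mass in the component weight cancels the normalization of the truncated Gaussian.
What remains is one density and one constant for all three components, so the pieces glue together.
-/
theorem ofReal_compProb_smul_truncGaussian (hκ : 0 ≤ κ) (hd : 0 < d) (he : 0 < e) (b : SignType) :
    ENNReal.ofReal (compProb φ ψ κ d e r t b) •
        truncGaussian (compMean φ ψ κ d e r t b) (compPrec d e b) (compSupport κ b)
      = ENNReal.ofReal (∑ b' : SignType, compWeight φ ψ κ d e r t b')⁻¹ •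
        (volume.restrict (compSupport κ b)).withDensity
          fun x => ENNReal.ofReal (coordDensity φ ψ κ d e r t x) := by
  have hW := sum_compWeight_pos (φ := φ) (ψ := ψ) (κ := κ) (r := r) (t := t) hd he
  have hmeas : Measurable fun x => ENNReal.ofReal (coordDensity φ ψ κ d e r t x) :=
    (measurable_coordDensity φ ψ κ d e r t).ennreal_ofReal
  rcases (truncMass_nonneg (compMean φ ψ κ d e r t b) (compPrec d e b)
    (compSupport κ b)).eq_or_lt with h0 | h0
  -- The mass can vanish: for `κ = 0` the central range is empty. Both sides are then zero.
  · have hw : compWeight φ ψ κ d e r t b = 0 := by rw [compWeight, ← h0, zero_mul]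
    have h1 : (volume.restrict (compSupport κ b)).withDensity
        (fun x => ENNReal.ofReal (coordDensity φ ψ κ d e r t x)) = 0 := by
      rw [← Measure.measure_univ_eq_zero, withDensity_apply _ .univ, Measure.restrict_univ,
        setLIntegral_coordDensity hκ hd he, hw, ENNReal.ofReal_zero]
    rw [h1, compProb, hw, zero_div, ENNReal.ofReal_zero, zero_smul, smul_zero]
  · rw [truncGaussian, ← withDensity_smul _ (by fun_prop), ← withDensity_smul _ hmeas]
    refine withDensity_congr_ae ?_
    filter_upwards [ae_restrict_mem (measurableSet_compSupport κ b)] with x hx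
    simp only [Pi.smul_apply, smul_eq_mul]
    rw [compProb, ← exp_compExponent_mul_exp hκ hd he hx,
      ← ENNReal.ofReal_mul (div_nonneg (compWeight_nonneg _ _ _ _ _ _ _ b) hW.le),
      ← ENNReal.ofReal_mul (inv_nonneg.2 hW.le)]
    congr 1
    simp only [compWeight] at hW ⊢
    have h0' := h0.ne'
    have hW' := hW.ne'
    field_simp

theorem volume_eq_sum_restrict_compSupport (hκ : 0 ≤ κ) :
    (volume : Measure ℝ) = ∑ b : SignType, volume.restrict (compSupport κ b) := by
  have hu : (volume : Measure ℝ).restrict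
      (compSupport κ .zero ∪ (compSupport κ .neg ∪ compSupport κ .pos)) = volume := by
    conv_rhs => rw [← Measure.restrict_univ (μ := (volume : Measure ℝ))]
    refine Measure.restrict_congr_set (Filter.eventuallyEq_univ.2 (mem_ae_iff.2 ?_))
    refine measure_mono_null (t := {κ, -κ}) (fun x hx => ?_) (Set.Finite.measure_zero (by simp) _)
    simp only [compSupport, Set.mem_compl_iff, Set.mem_union, Set.mem_Ioo, Set.mem_Iio,
      Set.mem_Ioi, not_or, not_and, not_lt] at hx
    simp only [Set.mem_insert_iff, Set.mem_singleton_iff]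
    rcases hx.2.1.eq_or_lt with h | h
    · exact Or.inr h.symm
    · exact Or.inl (le_antisymm hx.2.2 (hx.1 h))
  conv_lhs => rw [← hu]
  rw [Measure.restrict_union, Measure.restrict_union]
  · rw [show (Finset.univ : Finset SignType) = {.zero, .neg, .pos} from rfl,
      Finset.sum_insert (by decide), Finset.sum_insert (by decide), Finset.sum_singleton]
  · exact Set.disjoint_left.2 fun x (h1 : x < -κ) (h2 : κ < x) => by linarith
  · exact measurableSet_compSupport _ _
  · refine Set.disjoint_left.2 fun x (h1 : x ∈ Set.Ioo (-κ) κ) h2 => ?_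
    rcases h2 with h2 | h2
    · exact lt_asymm h1.1 h2
    · exact lt_asymm h1.2 h2
  · exact (measurableSet_compSupport _ _).union (measurableSet_compSupport _ _)

theorem coordLaw_eq_smul_withDensity (hκ : 0 ≤ κ) (hd : 0 < d) (he : 0 < e) :
    coordLaw φ ψ κ d e r t
      = ENNReal.ofReal (∑ b : SignType, compWeight φ ψ κ d e r t b)⁻¹ •
        volume.withDensity fun x => ENNReal.ofReal (coordDensity φ ψ κ d e r t x) := by
  conv_rhs => rw [volume_eq_sum_restrict_compSupport hκ]
  ext A hA
  simp only [coordLaw, ofReal_compProb_smul_truncGaussian hκ hd he, Measure.finsetSum_apply,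
    Measure.smul_apply, smul_eq_mul, withDensity_apply _ hA, ← Finset.mul_sum]
  simp only [← lintegral_indicator hA, lintegral_finsetSum_measure]

theorem lintegral_coordDensity (hκ : 0 ≤ κ) (hd : 0 < d) (he : 0 < e) :
    ∫⁻ x, ENNReal.ofReal (coordDensity φ ψ κ d e r t x)
      = ENNReal.ofReal (∑ b : SignType, compWeight φ ψ κ d e r t b) := by
  rw [volume_eq_sum_restrict_compSupport hκ, lintegral_finsetSum_measure,
    ENNReal.ofReal_sum_of_nonneg fun b _ => compWeight_nonneg _ _ _ _ _ _ _ b]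
  exact Finset.sum_congr rfl fun b _ => setLIntegral_coordDensity hκ hd he b

theorem isProbabilityMeasure_coordLaw (hκ : 0 ≤ κ) (hd : 0 < d) (he : 0 < e) :
    IsProbabilityMeasure (coordLaw φ ψ κ d e r t) := by
  have hW := sum_compWeight_pos (φ := φ) (ψ := ψ) (κ := κ) (r := r) (t := t) hd he
  refine ⟨?_⟩
  rw [coordLaw_eq_smul_withDensity hκ hd he, Measure.smul_apply, withDensity_apply _ .univ,
    Measure.restrict_univ, lintegral_coordDensity hκ hd he, smul_eq_mul,
    ← ENNReal.ofReal_mul (inv_nonneg.2 hW.le), inv_mul_cancel₀ hW.ne', ENNReal.ofReal_one]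

end Coord

/-! ### Mean excess of truncated Gaussians -/

/-- Mean of the half-normal distribution with precision `τ`. -/
def halfNormalMean (τ : ℝ) : ℝ :=
  (∫ u in Set.Ioi (0 : ℝ), u * Real.exp (-(τ / 2) * u ^ 2)) /
    ∫ u in Set.Ioi (0 : ℝ), Real.exp (-(τ / 2) * u ^ 2)

theorem halfNormalMean_nonneg (τ : ℝ) : 0 ≤ halfNormalMean τ :=
  div_nonneg (setIntegral_nonneg measurableSet_Ioi fun _ hu =>
    mul_nonneg (le_of_lt hu) (Real.exp_pos _).le)
    (integral_nonneg fun _ => (Real.exp_pos _).le)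

theorem integrable_sub_mul_exp_neg_mul_sub_sq {τ : ℝ} (hτ : 0 < τ) (a m : ℝ) :
    Integrable fun x : ℝ => (x - m) * Real.exp (-(τ / 2) * (x - a) ^ 2) := by
  have h1 := (integrable_mul_exp_neg_mul_sq (half_pos hτ)).comp_sub_right a
  have h2 := (integrable_exp_neg_mul_sub_sq hτ a).const_mul (a - m)
  refine (h1.add h2).congr (Filter.Eventually.of_forall fun x => ?_)
  simp only [Pi.add_apply]
  ring

/-- Beyond its mode, a Gaussian has mean excess at most that of the half-normal distribution. -/
theorem setIntegral_sub_mul_exp_le {τ : ℝ} (hτ : 0 < τ) {a m : ℝ} (ham : a ≤ m) :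
    ∫ x in Set.Ioi m, (x - m) * Real.exp (-(τ / 2) * (x - a) ^ 2)
      ≤ halfNormalMean τ * truncMass a τ (Set.Ioi m) := by
  set u₀ := halfNormalMean τ with hu
  set c := m - a with hc
  have hc0 : 0 ≤ c := sub_nonneg.2 ham
  have hshift : ∀ g : ℝ → ℝ, ∫ x in Set.Ioi m, g x = ∫ u in Set.Ioi (0 : ℝ), g (u + m) := by
    intro g
    have := (measurePreserving_add_right (volume : Measure ℝ) m).setIntegral_preimage_emb
      (measurableEmbedding_addRight m) g (Set.Ioi m)
    rw [← this]
    congr 2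
    ext x; simp
  rw [truncMass, hshift, hshift, ← integral_const_mul, ← sub_nonpos, ← integral_sub]
  rotate_left
  · have := (integrable_sub_mul_exp_neg_mul_sub_sq hτ a m).comp_add_right m
    exact this.integrableOn
  · exact (((integrable_exp_neg_mul_sub_sq hτ a).comp_add_right m).const_mul u₀).integrableOn
  have hw : Integrable fun u : ℝ => Real.exp (-(τ / 2) * u ^ 2) :=
    integrable_exp_neg_mul_sq (half_pos hτ)
  have huw : Integrable fun u : ℝ => u * Real.exp (-(τ / 2) * u ^ 2) :=
    integrable_mul_exp_neg_mul_sq (half_pos hτ)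
  have hwpos : 0 < ∫ u in Set.Ioi (0 : ℝ), Real.exp (-(τ / 2) * u ^ 2) := by
    have := truncMass_pos hτ 0 (s := Set.Ioi (0 : ℝ)) (by simp)
    simpa [truncMass] using this
  have hzero : ∫ u in Set.Ioi (0 : ℝ), (u - u₀) * Real.exp (-(τ / 2) * u ^ 2) = 0 := by
    have : (fun u : ℝ => (u - u₀) * Real.exp (-(τ / 2) * u ^ 2)) = fun u =>
        u * Real.exp (-(τ / 2) * u ^ 2) - u₀ * Real.exp (-(τ / 2) * u ^ 2) := by
      ext u; ring
    rw [this, integral_sub huw.integrableOn (hw.const_mul _).integrableOn, integral_const_mul,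
      hu, halfNormalMean, div_mul_cancel₀ _ hwpos.ne', sub_self]
  -- After the shift, the weight is the half-normal weight times a constant times the decreasing
  -- factor `exp (-(τ * c * u))`. Freezing that factor at `u₀` can only increase the integrand,
  -- whichever side of `u₀` the point `u` is on; the frozen integral vanishes because `u₀` is the
  -- half-normal mean.
  set A := Real.exp (-(τ / 2) * c ^ 2 - τ * c * u₀) with hA
  calc _ ≤ ∫ u in Set.Ioi (0 : ℝ), A * ((u - u₀) * Real.exp (-(τ / 2) * u ^ 2)) := by
        refine integral_mono ?_ ?_ fun u => ?_
        · have h1 := (integrable_sub_mul_exp_neg_mul_sub_sq hτ a m).comp_add_right m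
          have h2 := ((integrable_exp_neg_mul_sub_sq hτ a).comp_add_right m).const_mul u₀
          exact (h1.sub h2).integrableOn
        · have h1 : Integrable fun u : ℝ => (u - u₀) * Real.exp (-(τ / 2) * u ^ 2) := by
            simpa using integrable_sub_mul_exp_neg_mul_sub_sq hτ 0 u₀
          exact (h1.const_mul A).integrableOn
        · have h1 : Real.exp (-(τ / 2) * (u + m - a) ^ 2)
              = Real.exp (-(τ / 2) * c ^ 2) * Real.exp (-(τ * c * u))
                * Real.exp (-(τ / 2) * u ^ 2) := by
            rw [← Real.exp_add, ← Real.exp_add]; congr 1; rw [hc]; ring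
          have h2 : A = Real.exp (-(τ / 2) * c ^ 2) * Real.exp (-(τ * c * u₀)) := by
            rw [← Real.exp_add, hA]; congr 1
          have h3 : (u - u₀) * (Real.exp (-(τ * c * u)) - Real.exp (-(τ * c * u₀))) ≤ 0 := by
            rcases le_total u u₀ with h | h
            · refine mul_nonpos_of_nonpos_of_nonneg (by linarith) (sub_nonneg.2 ?_)
              refine Real.exp_le_exp.2 (neg_le_neg ?_)
              exact mul_le_mul_of_nonneg_left h (by positivity)
            · refine mul_nonpos_of_nonneg_of_nonpos (by linarith) (sub_nonpos.2 ?_)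
              refine Real.exp_le_exp.2 (neg_le_neg ?_)
              exact mul_le_mul_of_nonneg_left h (by positivity)
          have h4 : 0 ≤ Real.exp (-(τ / 2) * c ^ 2) * Real.exp (-(τ / 2) * u ^ 2) := by positivity
          simp only [h1, h2]
          have h5 := mul_nonpos_of_nonneg_of_nonpos h4 h3
          nlinarith
    _ = 0 := by rw [integral_const_mul, hzero, mul_zero]

/-- `ENNReal.ofReal` keeps only the tail beyond `m`, and the normalizing mass beyond `k` is at least
the mass beyond `m`, so the mean excess bound carries over. -/
theorem lintegral_sub_truncGaussian_Ioi_le {τ : ℝ} (hτ : 0 < τ) {a k m : ℝ} (ham : a ≤ m)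
    (hkm : k ≤ m) :
    ∫⁻ x, ENNReal.ofReal (x - m) ∂truncGaussian a τ (Set.Ioi k)
      ≤ ENNReal.ofReal (halfNormalMean τ) := by
  have hpos : 0 < truncMass a τ (Set.Ioi k) := truncMass_pos hτ a (by simp)
  have hle : truncMass a τ (Set.Ioi m) ≤ truncMass a τ (Set.Ioi k) :=
    setIntegral_mono_set (integrable_exp_neg_mul_sub_sq hτ a).integrableOn
      (Filter.Eventually.of_forall fun _ => (Real.exp_pos _).le)
      (LE.le.eventuallyLE (Set.Ioi_subset_Ioi hkm))
  have hi := (integrable_sub_mul_exp_neg_mul_sub_sq hτ a m).integrableOn (s := Set.Ioi m)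
  have h1 : ∫⁻ x, ENNReal.ofReal (x - m) ∂truncGaussian a τ (Set.Ioi k)
      = ENNReal.ofReal (truncMass a τ (Set.Ioi k))⁻¹ *
        ∫⁻ x in Set.Ioi m, ENNReal.ofReal ((x - m) * Real.exp (-(τ / 2) * (x - a) ^ 2)) := by
    rw [truncGaussian, lintegral_withDensity_eq_lintegral_mul _ (by fun_prop) (by fun_prop),
      ← lintegral_const_mul _ (by fun_prop), ← lintegral_indicator measurableSet_Ioi,
      ← lintegral_indicator measurableSet_Ioi]
    refine lintegral_congr fun x => ?_
    by_cases hx : m < x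
    · rw [Set.indicator_of_mem (by exact hkm.trans_lt hx), Set.indicator_of_mem (by exact hx),
        Pi.mul_apply, ← ENNReal.ofReal_mul (by positivity), ← ENNReal.ofReal_mul (by positivity)]
      congr 1
      ring
    · rw [Set.indicator_of_notMem (s := Set.Ioi m) (by exact hx)]
      refine Set.indicator_apply_eq_zero.2 fun _ => ?_
      rw [Pi.mul_apply, ENNReal.ofReal_of_nonpos (p := x - m) (by linarith), mul_zero]
  rw [h1, ← ofReal_integral_eq_lintegral_ofReal hi (by
      filter_upwards [ae_restrict_mem measurableSet_Ioi] with x hx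
      exact mul_nonneg (sub_nonneg.2 (le_of_lt hx)) (Real.exp_pos _).le),
    ← ENNReal.ofReal_mul (by positivity)]
  refine ENNReal.ofReal_le_ofReal ?_
  rw [inv_mul_le_iff₀ hpos, mul_comm]
  exact (setIntegral_sub_mul_exp_le hτ ham).trans
    (mul_le_mul_of_nonneg_left hle (halfNormalMean_nonneg τ))

theorem truncGaussian_Iio_eq_map (a τ k : ℝ) :
    truncGaussian a τ (Set.Iio (-k)) = (truncGaussian (-a) τ (Set.Ioi k)).map fun x => -x := by
  have hmp : MeasurePreserving (fun x : ℝ => -x) (volume.restrict (Set.Ioi k))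
      (volume.restrict (Set.Iio (-k))) := by
    have := (Measure.measurePreserving_neg (volume : Measure ℝ)).restrict_preimage
      (measurableSet_Iio (a := -k))
    simpa using this
  have hmass : truncMass a τ (Set.Iio (-k)) = truncMass (-a) τ (Set.Ioi k) := by
    rw [truncMass, truncMass, ← hmp.integral_comp (Homeomorph.neg ℝ).measurableEmbedding]
    congr 1
    ext x
    congr 2
    ring
  rw [truncGaussian, truncGaussian, ← hmp.map_eq, ← map_withDensity_comp measurable_neg _
    (by fun_prop), hmass]
  congr 2
  ext x
  simp only [Function.comp_apply]
  congr 4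
  ring

/-- The threshold dominates `κ` and the absolute means of both outer components: the central
component never exceeds it, and each outer one exceeds it by at most the half-normal mean on
average. The component probabilities are merely bounded by `1`, whence the factor `3`. What matters
for the drift is that `|r + t|` enters with coefficient exactly `1 / (d + e)`. -/
theorem lintegral_abs_sub_coordLaw_le {φ ψ κ d e r t : ℝ} (hκ : 0 ≤ κ) (hd : 0 < d) (he : 0 < e) :
    ∫⁻ x, ENNReal.ofReal (|x| - (|r + t| / (d + e) + ((|φ| + |ψ| + d * κ) / (d + e) + κ)))
        ∂coordLaw φ ψ κ d e r t
      ≤ 3 * ENNReal.ofReal (halfNormalMean (d + e)) := by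
  set m := |r + t| / (d + e) + ((|φ| + |ψ| + d * κ) / (d + e) + κ) with hm
  have hde : 0 < d + e := by positivity
  have hκm : κ ≤ m := by
    have : 0 ≤ |r + t| / (d + e) + (|φ| + |ψ| + d * κ) / (d + e) := by positivity
    rw [hm]; linarith
  have hmean : ∀ s : ℝ, |s| ≤ d * κ → |(φ + r + ψ + t + s) / (d + e)| ≤ m := fun s hs => by
    rw [abs_div, abs_of_pos hde]
    have h1 : |φ + r + ψ + t + s| ≤ |r + t| + (|φ| + |ψ| + d * κ) := by
      have h2 : φ + r + ψ + t + s = (r + t) + φ + ψ + s := by ring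
      rw [h2]
      have h3 := abs_add_le ((r + t) + φ + ψ) s
      have h4 := abs_add_le ((r + t) + φ) ψ
      have h5 := abs_add_le (r + t) φ
      linarith
    calc |φ + r + ψ + t + s| / (d + e) ≤ (|r + t| + (|φ| + |ψ| + d * κ)) / (d + e) := by gcongr
      _ ≤ m := by rw [hm, add_div]; linarith
  have hcomp : ∀ b : SignType, ∫⁻ x, ENNReal.ofReal (|x| - m) ∂truncGaussian
      (compMean φ ψ κ d e r t b) (compPrec d e b) (compSupport κ b)
        ≤ ENNReal.ofReal (halfNormalMean (d + e)) := by
    intro b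
    cases b with
    | zero =>
      refine le_trans (le_of_eq ?_) zero_le
      rw [truncGaussian, lintegral_withDensity_eq_lintegral_mul _ (by fun_prop) (by fun_prop)]
      refine (setLIntegral_congr_fun measurableSet_Ioo (g := fun _ => 0) fun x hx => ?_).trans
        lintegral_zero
      rw [Pi.mul_apply, ENNReal.ofReal_of_nonpos (p := |x| - m) (by
        have := abs_lt.2 hx; linarith), mul_zero]
    | pos =>
      have hs := hmean (d * κ) (abs_of_nonneg (by positivity)).le
      refine le_trans (le_of_eq ?_) (lintegral_sub_truncGaussian_Ioi_le hde
        (le_of_abs_le hs) hκm)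
      have hae : ∀ᵐ x ∂truncGaussian ((φ + r + ψ + t + d * κ) / (d + e)) (d + e) (Set.Ioi κ),
          κ < x := (withDensity_absolutelyContinuous _ _).ae_le (ae_restrict_mem measurableSet_Ioi)
      refine lintegral_congr_ae ?_
      change (fun x => _) =ᵐ[truncGaussian ((φ + r + ψ + t + d * κ) / (d + e)) (d + e)
        (Set.Ioi κ)] _
      filter_upwards [hae] with x hx
      rw [abs_of_pos (hκ.trans_lt hx)]
    | neg =>
      have hs := hmean (-(d * κ)) (by rw [abs_neg, abs_of_nonneg (by positivity)])
      rw [← sub_eq_add_neg] at hs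
      refine le_trans (le_of_eq ?_) (lintegral_sub_truncGaussian_Ioi_le hde
        ((neg_le_abs _).trans hs) hκm)
      change ∫⁻ x, _ ∂truncGaussian ((φ + r + ψ + t - d * κ) / (d + e)) (d + e)
        (Set.Iio (-κ)) = _
      rw [truncGaussian_Iio_eq_map, lintegral_map (by fun_prop) measurable_neg]
      have hae : ∀ᵐ x ∂truncGaussian (-((φ + r + ψ + t - d * κ) / (d + e))) (d + e) (Set.Ioi κ),
          κ < x := (withDensity_absolutelyContinuous _ _).ae_le (ae_restrict_mem measurableSet_Ioi)
      refine lintegral_congr_ae ?_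
      filter_upwards [hae] with x hx
      rw [abs_neg, abs_of_pos (hκ.trans_lt hx)]
  have hprob : ∀ b : SignType, ENNReal.ofReal (compProb φ ψ κ d e r t b) ≤ 1 := fun b => by
    rw [← ENNReal.ofReal_one]
    refine ENNReal.ofReal_le_ofReal (div_le_one_of_le₀ ?_ ?_)
    · exact Finset.single_le_sum (f := compWeight φ ψ κ d e r t)
        (fun b' _ => compWeight_nonneg φ ψ κ d e r t b') (Finset.mem_univ b)
    · exact Finset.sum_nonneg fun b' _ => compWeight_nonneg φ ψ κ d e r t b'
  rw [coordLaw, lintegral_finsetSum_measure]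
  calc _ ≤ ∑ _b : SignType, ENNReal.ofReal (halfNormalMean (d + e)) := by
        refine Finset.sum_le_sum fun b _ => ?_
        rw [lintegral_smul_measure, smul_eq_mul]
        exact (mul_le_mul' (hprob b) (hcomp b)).trans (one_mul _).le
    _ = 3 * ENNReal.ofReal (halfNormalMean (d + e)) := by
        rw [Finset.sum_const, Finset.card_univ, show Fintype.card SignType = 3 from rfl,
          nsmul_eq_mul, Nat.cast_ofNat]

/-! ### Soft thresholding -/

theorem norm_le_norm_of_abs_le {x y : Vec p} (h : ∀ j, |x j| ≤ |y j|) : ‖x‖ ≤ ‖y‖ := by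
  rw [EuclideanSpace.norm_eq, EuclideanSpace.norm_eq]
  refine Real.sqrt_le_sqrt (Finset.sum_le_sum fun j _ => ?_)
  rw [Real.norm_eq_abs, Real.norm_eq_abs]
  exact pow_le_pow_left₀ (abs_nonneg _) (h j) 2

theorem softThreshold_apply (κ β : Vec p) (j : Fin p) :
    softThreshold κ β j = Real.sign (β j) * max (|β j| - κ j) 0 := rfl

theorem abs_sign_mul_max_le {k x : ℝ} (hk : 0 ≤ k) : |Real.sign x * max (|x| - k) 0| ≤ |x| := by
  rw [abs_mul, abs_of_nonneg (le_max_right (|x| - k) 0)]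
  have h1 : |Real.sign x| ≤ 1 := by
    rcases Real.sign_apply_eq x with h | h | h <;> simp [h]
  have h2 : max (|x| - k) 0 ≤ |x| := max_le (by linarith) (abs_nonneg _)
  calc _ ≤ 1 * |x| := mul_le_mul h1 h2 (le_max_right _ _) zero_le_one
    _ = |x| := one_mul _

theorem abs_sign_mul_max_sub_le {k x : ℝ} (hk : 0 ≤ k) :
    |Real.sign x * max (|x| - k) 0 - x| ≤ |k| := by
  rw [abs_of_nonneg hk]
  rcases lt_trichotomy x 0 with h | rfl | h
  · rw [Real.sign_of_neg h, abs_of_neg h]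
    rcases max_cases (-x - k) 0 with ⟨h1, h2⟩ | ⟨h1, h2⟩ <;> rw [h1, abs_le] <;>
      constructor <;> linarith
  · simpa using hk
  · rw [Real.sign_of_pos h, abs_of_pos h]
    rcases max_cases (x - k) 0 with ⟨h1, h2⟩ | ⟨h1, h2⟩ <;> rw [h1, abs_le] <;>
      constructor <;> linarith

theorem norm_softThreshold_le {κ : Vec p} (hκ : ∀ j, 0 ≤ κ j) (β : Vec p) :
    ‖softThreshold κ β‖ ≤ ‖β‖ :=
  norm_le_norm_of_abs_le fun j => abs_sign_mul_max_le (hκ j)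

theorem norm_softThreshold_sub_le {κ : Vec p} (hκ : ∀ j, 0 ≤ κ j) (β : Vec p) :
    ‖softThreshold κ β - β‖ ≤ ‖κ‖ :=
  norm_le_norm_of_abs_le fun j => abs_sign_mul_max_sub_le (hκ j)

/-! ### Properness of the posterior -/

theorem inner_matMap_add_smul {A : Matrix (Fin p) (Fin p) ℝ} (hA : A.IsHermitian) {v : Vec p}
    (hv : matMap A v = 0) (c : ℝ) (x : Vec p) :
    inner ℝ (c • v + x) (matMap A (c • v + x)) = inner ℝ x (matMap A x) := by
  rw [map_add, map_smul, hv, smul_zero, zero_add, inner_add_left, inner_smul_left,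
    ← inner_matMap_comm hA, hv, inner_zero_left, mul_zero, zero_add]

theorem inner_matMap_le (A : Matrix (Fin p) (Fin p) ℝ) (x : Vec p) :
    inner ℝ x (matMap A x) ≤ ‖matMap A‖ * ‖x‖ ^ 2 := by
  calc inner ℝ x (matMap A x) ≤ ‖x‖ * ‖matMap A x‖ := real_inner_le_norm _ _
    _ ≤ ‖x‖ * (‖matMap A‖ * ‖x‖) := by gcongr; exact (matMap A).le_opNorm x
    _ = _ := by ring

theorem neg_le_inner_of_norm_le (x : Vec p) {y : Vec p} {B : ℝ} (hy : ‖y‖ ≤ B) :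
    -(‖x‖ * B) ≤ inner ℝ x y := by
  have h1 := (abs_le.1 (abs_real_inner_le_norm x y)).1
  have h2 : ‖x‖ * ‖y‖ ≤ ‖x‖ * B := by gcongr
  linarith

/-- A common null direction of `M` and `H` makes the posterior improper. -/
theorem not_integrable_posteriorDensity {M H : Matrix (Fin p) (Fin p) ℝ} {φ ψ κ : Vec p}
    (hM : M.IsHermitian) (hH : H.IsHermitian) (hκ : ∀ j, 0 ≤ κ j) {v : Vec p} (hv : v ≠ 0)
    (hMv : matMap M v = 0) (hHv : matMap H v = 0) (hdir : 0 ≤ inner ℝ φ v + inner ℝ ψ v) :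
    ¬ Integrable (posteriorDensity M H φ ψ κ) volume := by
  intro hint
  have hv0 : 0 < ‖v‖ := norm_pos_iff.2 hv
  set B := ‖v‖ / 2 + ‖κ‖ with hB
  have hB0 : 0 ≤ B := by positivity
  set c := Real.exp (-(1 / 2) * (‖matMap M‖ * B ^ 2) - ‖φ‖ * B) *
    Real.exp (-(1 / 2) * (‖matMap H‖ * B ^ 2) - ‖ψ‖ * B) with hc
  have hc0 : 0 < c := by positivity
  -- Near `n • v` the quadratic forms do not see `n • v`, the linear terms gain the nonnegative
  -- amount from `hdir`, and soft thresholding displaces by at most `‖κ‖`. So one constant works for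
  -- all `n`.
  have hlow : ∀ n : ℕ, ∀ β ∈ Metric.ball ((n : ℝ) • v) (‖v‖ / 2),
      c ≤ posteriorDensity M H φ ψ κ β := by
    intro n β hβ
    rw [mem_ball_iff_norm] at hβ
    obtain ⟨u, rfl⟩ : ∃ u, β = (n : ℝ) • v + u := ⟨β - (n : ℝ) • v, by abel⟩
    rw [add_sub_cancel_left] at hβ
    obtain ⟨w, hw⟩ : ∃ w, softThreshold κ ((n : ℝ) • v + u) = (n : ℝ) • v + w :=
      ⟨softThreshold κ ((n : ℝ) • v + u) - (n : ℝ) • v, by abel⟩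
    have hwB : ‖w‖ ≤ B := by
      have h1 := norm_softThreshold_sub_le hκ ((n : ℝ) • v + u)
      rw [hw, add_sub_add_left_eq_sub] at h1
      have h2 := norm_add_le (w - u) u
      rw [sub_add_cancel] at h2
      linarith
    have huB : ‖u‖ ≤ B := by
      have := norm_nonneg κ
      linarith
    have hsq : ∀ x : Vec p, ‖x‖ ≤ B → ∀ A : Matrix (Fin p) (Fin p) ℝ,
        inner ℝ x (matMap A x) ≤ ‖matMap A‖ * B ^ 2 := fun x hx A =>
      (inner_matMap_le A x).trans (by gcongr)
    rw [posteriorDensity, hw, inner_matMap_add_smul hM hMv, inner_matMap_add_smul hH hHv,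
      inner_add_right, inner_add_right, inner_smul_right, inner_smul_right, hc, ← Real.exp_add,
      ← Real.exp_add]
    refine Real.exp_le_exp.2 ?_
    have h1 := hsq w hwB M
    have h2 := hsq u huB H
    have h3 := neg_le_inner_of_norm_le φ hwB
    have h4 := neg_le_inner_of_norm_le ψ huB
    have h5 : 0 ≤ (n : ℝ) * (inner ℝ φ v + inner ℝ ψ v) := mul_nonneg (Nat.cast_nonneg n) hdir
    linarith
  have hfin : volume {β | c ≤ ‖posteriorDensity M H φ ψ κ β‖} < ⊤ :=
    hint.measure_norm_ge_lt_top hc0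
  have hsub : (⋃ n : ℕ, Metric.ball ((n : ℝ) • v) (‖v‖ / 2))
      ⊆ {β | c ≤ ‖posteriorDensity M H φ ψ κ β‖} :=
    Set.iUnion_subset fun n β hβ => (hlow n β hβ).trans (le_abs_self _)
  -- The radius `‖v‖ / 2` makes the balls disjoint. Their union has infinite volume, whereas an
  -- integrable density exceeds `c` only on a set of finite volume.
  have hdisj : Pairwise (Function.onFun Disjoint
      fun n : ℕ => Metric.ball ((n : ℝ) • v) (‖v‖ / 2)) := by
    intro m n hmn
    refine Metric.ball_disjoint_ball ?_
    rw [dist_eq_norm, ← sub_smul, norm_smul, add_halves]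
    refine le_mul_of_one_le_left hv0.le ?_
    have h1 : (1 : ℤ) ≤ |(m : ℤ) - n| :=
      Int.one_le_abs (sub_ne_zero.2 (by exact_mod_cast hmn))
    rw [Real.norm_eq_abs]
    exact_mod_cast h1
  have hvol := measure_iUnion (μ := (volume : Measure (Vec p))) hdisj
    fun n => Metric.isOpen_ball.measurableSet
  have hball : ∀ n : ℕ, volume (Metric.ball ((n : ℝ) • v) (‖v‖ / 2))
      = volume (Metric.ball (0 : Vec p) (‖v‖ / 2)) := fun n => Measure.addHaar_ball_center _ _ _
  simp only [hball] at hvol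
  rw [ENNReal.tsum_const_eq_top_of_ne_zero
    (Metric.measure_ball_pos volume (0 : Vec p) (by positivity)).ne'] at hvol
  have := (measure_mono hsub).trans_lt hfin
  rw [hvol] at this
  exact lt_irrefl _ this

/-- One of `v` and `-v` has a nonnegative linear term, and properness already fails along that ray.
-/
theorem eq_zero_of_integrable_posteriorDensity {M H : Matrix (Fin p) (Fin p) ℝ} {φ ψ κ : Vec p}
    (hM : M.IsHermitian) (hH : H.IsHermitian) (hκ : ∀ j, 0 ≤ κ j)
    (hint : Integrable (posteriorDensity M H φ ψ κ) volume) {v : Vec p}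
    (hMv : matMap M v = 0) (hHv : matMap H v = 0) : v = 0 := by
  by_contra hv
  rcases le_total 0 (inner ℝ φ v + inner ℝ ψ v) with h | h
  · exact not_integrable_posteriorDensity hM hH hκ hv hMv hHv h hint
  · refine not_integrable_posteriorDensity hM hH hκ (neg_ne_zero.2 hv) (by rw [map_neg, hMv, neg_zero])
      (by rw [map_neg, hHv, neg_zero]) ?_ hint
    rw [inner_neg_right, inner_neg_right]
    linarith

/-! ### Contraction of the conditional means -/

theorem matMap_smul_one_sub_apply (c : ℝ) (A : Matrix (Fin p) (Fin p) ℝ) (x : Vec p) :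
    matMap (c • (1 : Matrix (Fin p) (Fin p) ℝ) - A) x = c • x - matMap A x := by
  rw [matMap, map_sub, map_smul, map_one]; rfl

theorem posSemidef_smul_one_sub {A : Matrix (Fin p) (Fin p) ℝ} (hA : A.IsHermitian) {c : ℝ}
    (hc : ‖matMap A‖ ≤ c) : (c • (1 : Matrix (Fin p) (Fin p) ℝ) - A).PosSemidef := by
  have hH : (c • (1 : Matrix (Fin p) (Fin p) ℝ) - A).IsHermitian := by
    refine Matrix.IsHermitian.sub ?_ hA
    rw [Matrix.IsHermitian, Matrix.conjTranspose_smul, Matrix.conjTranspose_one, star_trivial]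
  refine Matrix.PosSemidef.of_dotProduct_mulVec_nonneg hH fun x => ?_
  have h1 := matMap_smul_one_sub_apply c A (WithLp.toLp 2 x)
  have h2 : inner ℝ (WithLp.toLp 2 x : Vec p)
      (matMap (c • (1 : Matrix (Fin p) (Fin p) ℝ) - A) (WithLp.toLp 2 x))
      = star x ⬝ᵥ ((c • (1 : Matrix (Fin p) (Fin p) ℝ) - A).mulVec x) := by
    rw [matMap, Matrix.inner_toEuclideanCLM]; rfl
  rw [← h2, h1, inner_sub_right, inner_smul_right, real_inner_self_eq_norm_sq]
  have h3 := inner_matMap_le A (WithLp.toLp 2 x)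
  have h4 : ‖matMap A‖ * ‖(WithLp.toLp 2 x : Vec p)‖ ^ 2 ≤ c * ‖(WithLp.toLp 2 x : Vec p)‖ ^ 2 := by
    gcongr
  linarith

open scoped MatrixOrder in
-- With `Q` the square root of `A`, `‖A x‖ ≤ ‖Q‖ ‖Q x‖`, while `‖Q‖² = ‖A‖` and `‖Q x‖²` is the
-- quadratic form. In particular a vanishing form forces `A x = 0`.
theorem norm_sq_matMap_le {A : Matrix (Fin p) (Fin p) ℝ} (hA : A.PosSemidef) (x : Vec p) :
    ‖matMap A x‖ ^ 2 ≤ ‖matMap A‖ * inner ℝ x (matMap A x) := by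
  set Q := CFC.sqrt A with hQ
  have hQQ : Q * Q = A := CFC.sqrt_mul_sqrt_self A hA.nonneg
  have hQs : Q.IsHermitian := (CFC.sqrt_nonneg A).isSelfAdjoint
  have hQa : IsSelfAdjoint (matMap Q) := IsSelfAdjoint.map hQs _
  have h1 : ‖matMap A‖ = ‖matMap Q‖ * ‖matMap Q‖ := by
    rw [← CStarRing.norm_star_mul_self, hQa.star_eq, ← map_mul, hQQ]
  have h2 : inner ℝ x (matMap A x) = ‖matMap Q x‖ ^ 2 := by
    rw [← hQQ, matMap_mul_apply, ← inner_matMap_comm hQs, real_inner_self_eq_norm_sq]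
  have h3 : ‖matMap A x‖ ≤ ‖matMap Q‖ * ‖matMap Q x‖ := by
    rw [← hQQ, matMap_mul_apply]
    exact (matMap Q).le_opNorm _
  rw [h1, h2]
  calc ‖matMap A x‖ ^ 2 ≤ (‖matMap Q‖ * ‖matMap Q x‖) ^ 2 := by gcongr
    _ = _ := by ring

theorem norm_sq_smul_sub_matMap_le {A : Matrix (Fin p) (Fin p) ℝ} (hA : A.PosSemidef) (c : ℝ)
    (x : Vec p) : ‖c • x - matMap A x‖ ^ 2
      ≤ (c * ‖x‖) ^ 2 - (2 * c - ‖matMap A‖) * inner ℝ x (matMap A x) := by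
  rw [norm_sub_sq_real, inner_smul_left, norm_smul, Real.norm_eq_abs, mul_pow, sq_abs]
  have := norm_sq_matMap_le hA x
  simp only [conj_trivial]
  linarith

theorem inner_matMap_nonneg {A : Matrix (Fin p) (Fin p) ℝ} (hA : A.PosSemidef) (x : Vec p) :
    0 ≤ inner ℝ x (matMap A x) := by
  by_contra h
  have h1 := norm_sq_matMap_le hA x
  have h2 : ‖matMap A‖ * inner ℝ x (matMap A x) ≤ 0 :=
    mul_nonpos_of_nonneg_of_nonpos (norm_nonneg _) (not_le.1 h).le
  have h3 : ‖matMap A x‖ = 0 := by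
    have := sq_nonneg ‖matMap A x‖
    exact pow_eq_zero_iff two_ne_zero |>.1 (le_antisymm (h1.trans h2) this)
  rw [norm_eq_zero.1 h3, inner_zero_right] at h
  exact h le_rfl

theorem norm_smul_sub_matMap_le {A : Matrix (Fin p) (Fin p) ℝ} (hA : A.PosSemidef) {c : ℝ}
    (hc : ‖matMap A‖ < c) (x : Vec p) : ‖c • x - matMap A x‖ ≤ c * ‖x‖ := by
  have hc0 : 0 ≤ c := (norm_nonneg _).trans hc.le
  refine le_of_sq_le_sq ?_ (by positivity)
  have h1 := norm_sq_smul_sub_matMap_le hA c x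
  have h2 : 0 ≤ (2 * c - ‖matMap A‖) * inner ℝ x (matMap A x) :=
    mul_nonneg (by linarith) (inner_matMap_nonneg hA x)
  linarith

theorem matMap_eq_zero_of_le_norm {A : Matrix (Fin p) (Fin p) ℝ} (hA : A.PosSemidef) {c : ℝ}
    (hc : ‖matMap A‖ < c) {x : Vec p} (hx : c * ‖x‖ ≤ ‖c • x - matMap A x‖) :
    matMap A x = 0 := by
  have hc0 : 0 < c := (norm_nonneg _).trans_lt hc
  have h1 := norm_sq_smul_sub_matMap_le hA c x
  have h2 : (c * ‖x‖) ^ 2 ≤ ‖c • x - matMap A x‖ ^ 2 := by gcongr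
  have h3 : inner ℝ x (matMap A x) ≤ 0 := by
    by_contra h
    have := mul_pos (by linarith : 0 < 2 * c - ‖matMap A‖) (not_le.1 h)
    linarith
  have h4 := norm_sq_matMap_le hA x
  have h5 := mul_nonpos_of_nonneg_of_nonpos (norm_nonneg (matMap A)) h3
  exact norm_eq_zero.1 (pow_eq_zero_iff two_ne_zero |>.1 (le_antisymm (h4.trans h5) (sq_nonneg _)))

/-- By compactness `‖T x‖` attains its maximum on the unit sphere, so the strict pointwise
inequality becomes a uniform one. -/
theorem exists_norm_le_mul_of_norm_lt {T : Vec p →L[ℝ] Vec p} {c : ℝ} (hc : 0 < c)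
    (h : ∀ x, x ≠ 0 → ‖T x‖ < c * ‖x‖) :
    ∃ l, 0 ≤ l ∧ l < 1 ∧ ∀ x, ‖T x‖ ≤ l * c * ‖x‖ := by
  rcases (Metric.sphere (0 : Vec p) 1).eq_empty_or_nonempty with hs | hs
  -- The sphere is empty when `p = 0`; every vector is then zero.
  · refine ⟨0, le_rfl, one_pos, fun x => ?_⟩
    have hx : x = 0 := by
      by_contra hx
      have : ‖x‖⁻¹ • x ∈ Metric.sphere (0 : Vec p) 1 := by
        rw [mem_sphere_zero_iff_norm, norm_smul, norm_inv, norm_norm,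
          inv_mul_cancel₀ (norm_ne_zero_iff.2 hx)]
      rw [hs] at this
      exact this
    simp [hx]
  · obtain ⟨z, hz, hmax⟩ := (isCompact_sphere (0 : Vec p) 1).exists_isMaxOn hs
      (f := fun x => ‖T x‖) (by fun_prop)
    rw [mem_sphere_zero_iff_norm] at hz
    refine ⟨‖T z‖ / c, by positivity, ?_, fun x => ?_⟩
    · rw [div_lt_one hc]
      have := h z (norm_ne_zero_iff.1 (by rw [hz]; exact one_ne_zero))
      rwa [hz, mul_one] at this
    · rw [div_mul_cancel₀ _ hc.ne']
      by_cases hx : x = 0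
      · simp [hx]
      have hx0 : 0 < ‖x‖ := norm_pos_iff.2 hx
      have hmem : ‖x‖⁻¹ • x ∈ Metric.sphere (0 : Vec p) 1 := by
        rw [mem_sphere_zero_iff_norm, norm_smul, norm_inv, norm_norm, inv_mul_cancel₀ hx0.ne']
      have h1 : ‖T (‖x‖⁻¹ • x)‖ ≤ ‖T z‖ := hmax hmem
      rw [map_smul, norm_smul, norm_inv, norm_norm, inv_mul_le_iff₀ hx0] at h1
      linarith

/-- Without a common null direction, the sum of the two conditional means of `r` and `t` is a
strict contraction of `(d + e) β`. -/
theorem exists_norm_sub_matMap_le {M H : Matrix (Fin p) (Fin p) ℝ} {d e : ℝ}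
    (hM : M.PosSemidef) (hH : H.PosSemidef) (hd : ‖matMap M‖ < d) (he : ‖matMap H‖ < e)
    (hnull : ∀ v : Vec p, matMap M v = 0 → matMap H v = 0 → v = 0) :
    ∃ l, 0 ≤ l ∧ l < 1 ∧ ∀ x : Vec p,
      ‖(d • x - matMap M x) + (e • x - matMap H x)‖ ≤ l * (d + e) * ‖x‖ := by
  have hd0 : 0 < d := (norm_nonneg _).trans_lt hd
  have he0 : 0 < e := (norm_nonneg _).trans_lt he
  obtain ⟨l, h0, h1, h⟩ := exists_norm_le_mul_of_norm_lt
    (T := (d • ContinuousLinearMap.id ℝ (Vec p) - matMap M)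
      + (e • ContinuousLinearMap.id ℝ (Vec p) - matMap H)) (c := d + e) (by positivity)
    (fun x hx => by
      change ‖(d • x - matMap M x) + (e • x - matMap H x)‖ < _
      -- Each summand is bounded by its own share `d * ‖x‖` or `e * ‖x‖`. Without strictness both
      -- shares are attained, which puts `x` in both null spaces.
      by_contra hlt
      have h1 := norm_smul_sub_matMap_le hM hd x
      have h2 := norm_smul_sub_matMap_le hH he x
      have h3 := norm_add_le (d • x - matMap M x) (e • x - matMap H x)
      have h4 := not_lt.1 hlt
      exact hx (hnull x (matMap_eq_zero_of_le_norm hM hd (by linarith))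
        (matMap_eq_zero_of_le_norm hH he (by linarith))))
  exact ⟨l, h0, h1, h⟩

/-! ### The joint density of `(β, r, t)` -/

/-- Unnormalized joint density of `(β, r, t)` with respect to the product of Lebesgue measure and
centred Gaussian measures. -/
def jointDensity (φ ψ κ : Vec p) (d e : ℝ) (s : State p) : ENNReal :=
  ∏ j, ENNReal.ofReal (coordDensity (φ j) (ψ j) (κ j) d e (s.2.1 j) (s.2.2 j) (s.1 j))

/-- Law of `(r, t)` given `β = 0`. -/
def latentReference (M H : Matrix (Fin p) (Fin p) ℝ) (d e : ℝ) : Measure (Latent p) :=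
  (multivariateGaussian (0 : Vec p) (d • (1 : Matrix (Fin p) (Fin p) ℝ) - M)).prod
    (multivariateGaussian (0 : Vec p) (e • (1 : Matrix (Fin p) (Fin p) ℝ) - H))

instance (M H : Matrix (Fin p) (Fin p) ℝ) (d e : ℝ) :
    IsProbabilityMeasure (latentReference M H d e) := by
  unfold latentReference; infer_instance

/-- Density of the law of `(r, t)` given `β` with respect to `latentReference`. -/
def latentDensity (M H : Matrix (Fin p) (Fin p) ℝ) (κ : Vec p) (d e : ℝ) (s : State p) : ℝ :=
  Real.exp (inner ℝ s.2.1 (softThreshold κ s.1) - inner ℝ (softThreshold κ s.1)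
      (matMap (d • (1 : Matrix (Fin p) (Fin p) ℝ) - M) (softThreshold κ s.1)) / 2) *
    Real.exp (inner ℝ s.2.2 s.1
      - inner ℝ s.1 (matMap (e • (1 : Matrix (Fin p) (Fin p) ℝ) - H) s.1) / 2)

instance (M H : Matrix (Fin p) (Fin p) ℝ) (κ : Vec p) (d e : ℝ) :
    IsMarkovKernel (latentKernel M H κ d e) := by
  unfold latentKernel; infer_instance

theorem latentKernel_apply (M H : Matrix (Fin p) (Fin p) ℝ) (κ : Vec p) (d e : ℝ) (β : Vec p) :
    latentKernel M H κ d e β = (antiGaussian d M (softThreshold κ β)).prod (antiGaussian e H β) := by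
  rw [latentKernel, Kernel.prod_apply, Kernel.comap_apply]
  rfl

/-- Both conditional means lie in the range of the covariance, so the Cameron–Martin formula gives
all these laws densities against one reference measure. -/
theorem latentKernel_eq_withDensity {M H : Matrix (Fin p) (Fin p) ℝ} {d e : ℝ}
    (hM : M.IsHermitian) (hH : H.IsHermitian) (hd : ‖matMap M‖ ≤ d) (he : ‖matMap H‖ ≤ e)
    (κ β : Vec p) :
    latentKernel M H κ d e β = (latentReference M H d e).withDensity
      fun q => ENNReal.ofReal (latentDensity M H κ d e (β, q)) := by
  rw [latentKernel_apply, antiGaussian, antiGaussian,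
    multivariateGaussian_matMap_eq (posSemidef_smul_one_sub hM hd),
    multivariateGaussian_matMap_eq (posSemidef_smul_one_sub hH he),
    prod_withDensity (by fun_prop) (by fun_prop), latentReference]
  congr 1
  ext q
  rw [latentDensity, ENNReal.ofReal_mul (Real.exp_pos _).le]

theorem coordDensity_nonneg (φ ψ κ d e r t x : ℝ) : 0 ≤ coordDensity φ ψ κ d e r t x :=
  (Real.exp_pos _).le

theorem measurable_latentDensity (M H : Matrix (Fin p) (Fin p) ℝ) (κ : Vec p) (d e : ℝ) :
    Measurable (latentDensity M H κ d e) := by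
  have h : Measurable fun s : State p => softThreshold κ s.1 :=
    (measurable_softThreshold κ).comp measurable_fst
  unfold latentDensity
  fun_prop

theorem measurable_posteriorDensity (M H : Matrix (Fin p) (Fin p) ℝ) (φ ψ κ : Vec p) :
    Measurable (posteriorDensity M H φ ψ κ) := by
  have h : Measurable fun β : Vec p => softThreshold κ β := measurable_softThreshold κ
  unfold posteriorDensity
  fun_prop

theorem posteriorDensity_pos (M H : Matrix (Fin p) (Fin p) ℝ) (φ ψ κ β : Vec p) :
    0 < posteriorDensity M H φ ψ κ β := by
  unfold posteriorDensity; positivity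

/-- This is the anti-correlation effect: `θ'Mθ + θ'(d I - M)θ = d ‖θ‖²`, and likewise for `H`, so
all coupling between coordinates disappears. -/
theorem posteriorDensity_mul_latentDensity (M H : Matrix (Fin p) (Fin p) ℝ) (φ ψ κ : Vec p)
    (d e : ℝ) (s : State p) :
    ENNReal.ofReal (posteriorDensity M H φ ψ κ s.1) * ENNReal.ofReal (latentDensity M H κ d e s)
      = jointDensity φ ψ κ d e s := by
  obtain ⟨β, r, t⟩ := s
  have hprod : ∏ j, coordDensity (φ j) (ψ j) (κ j) d e (r j) (t j) (β j)
      = Real.exp (-(d / 2) * inner ℝ (softThreshold κ β) (softThreshold κ β)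
        + (inner ℝ φ (softThreshold κ β) + inner ℝ r (softThreshold κ β))
        - e / 2 * inner ℝ β β + (inner ℝ ψ β + inner ℝ t β)) := by
    simp only [coordDensity, ← Real.exp_sum, PiLp.inner_apply, softThreshold_apply,
      Finset.mul_sum, ← Finset.sum_add_distrib, ← Finset.sum_sub_distrib]
    congr 1
    refine Finset.sum_congr rfl fun j _ => ?_
    simp only [RCLike.inner_apply, conj_trivial]
    ring
  rw [jointDensity, ← ENNReal.ofReal_prod_of_nonneg fun j _ => coordDensity_nonneg _ _ _ _ _ _ _ _]
  simp only
  rw [hprod, ← ENNReal.ofReal_mul (posteriorDensity_pos _ _ _ _ _ _).le, posteriorDensity,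
    latentDensity, ← Real.exp_add, ← Real.exp_add, ← Real.exp_add, matMap_smul_one_sub_apply,
    matMap_smul_one_sub_apply, inner_sub_right, inner_sub_right, inner_smul_right,
    inner_smul_right]
  congr 2
  ring

theorem measurable_jointDensity (φ ψ κ : Vec p) (d e : ℝ) :
    Measurable (jointDensity φ ψ κ d e) := by
  -- The joint density does not involve `M` and `H`, so both may be taken to be `0` in the
  -- factorization.
  have h := ((measurable_posteriorDensity 0 0 φ ψ κ).comp
    (measurable_fst (α := Vec p) (β := Latent p))).ennreal_ofReal.mul
    (measurable_latentDensity 0 0 κ d e).ennreal_ofReal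
  exact (funext fun s => posteriorDensity_mul_latentDensity 0 0 φ ψ κ d e s) ▸ h

theorem lintegral_posteriorDensity_ne_zero (M H : Matrix (Fin p) (Fin p) ℝ) (φ ψ κ : Vec p) :
    ∫⁻ β, ENNReal.ofReal (posteriorDensity M H φ ψ κ β) ≠ 0 := by
  intro h
  rw [lintegral_eq_zero_iff (measurable_posteriorDensity M H φ ψ κ).ennreal_ofReal] at h
  have h2 : ∀ᵐ _β : Vec p, False := by
    filter_upwards [h] with β hβ
    exact (ENNReal.ofReal_pos.2 (posteriorDensity_pos M H φ ψ κ β)).ne' hβ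
  exact NeZero.ne (volume : Measure (Vec p)) (by simpa using h2)

theorem isProbabilityMeasure_posterior {M H : Matrix (Fin p) (Fin p) ℝ} {φ ψ κ : Vec p}
    (h : Integrable (posteriorDensity M H φ ψ κ) volume) :
    IsProbabilityMeasure (posterior M H φ ψ κ) := by
  refine ⟨?_⟩
  rw [posterior, Measure.smul_apply, withDensity_apply _ .univ, Measure.restrict_univ, smul_eq_mul]
  exact ENNReal.inv_mul_cancel (lintegral_posteriorDensity_ne_zero M H φ ψ κ)
    h.lintegral_lt_top.ne

theorem jointPosterior_eq_smul_withDensity {M H : Matrix (Fin p) (Fin p) ℝ} {d e : ℝ}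
    (hM : M.IsHermitian) (hH : H.IsHermitian) (hd : ‖matMap M‖ ≤ d) (he : ‖matMap H‖ ≤ e)
    {φ ψ κ : Vec p} (h : Integrable (posteriorDensity M H φ ψ κ) volume) :
    posterior M H φ ψ κ ⊗ₘ latentKernel M H κ d e
      = (∫⁻ β, ENNReal.ofReal (posteriorDensity M H φ ψ κ β))⁻¹ •
        ((volume : Measure (Vec p)).prod (latentReference M H d e)).withDensity
          (jointDensity φ ψ κ d e) := by
  have := isProbabilityMeasure_posterior h
  have hj := measurable_jointDensity φ ψ κ d e
  ext A hA
  rw [Measure.compProd_apply hA, posterior, lintegral_smul_measure, Measure.smul_apply]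
  congr 1
  rw [lintegral_withDensity_eq_lintegral_mul _
      (measurable_posteriorDensity M H φ ψ κ).ennreal_ofReal
      (Kernel.measurable_kernel_prodMk_left hA),
    withDensity_apply _ hA, ← lintegral_indicator hA, lintegral_prod _
      (hj.indicator hA).aemeasurable]
  refine lintegral_congr fun β => ?_
  have hAβ : MeasurableSet (Prod.mk β ⁻¹' A) := measurable_prodMk_left hA
  have hlβ : Measurable fun q => ENNReal.ofReal (latentDensity M H κ d e (β, q)) :=
    ((measurable_latentDensity M H κ d e).comp measurable_prodMk_left).ennreal_ofReal
  rw [Pi.mul_apply, latentKernel_eq_withDensity hM hH hd he, withDensity_apply _ hAβ,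
    ← lintegral_const_mul _ hlβ, ← lintegral_indicator hAβ]
  refine lintegral_congr fun q => ?_
  by_cases hq : (β, q) ∈ A
  · rw [Set.indicator_of_mem (by exact hq), Set.indicator_of_mem hq,
      ← posteriorDensity_mul_latentDensity M H]
  · rw [Set.indicator_of_notMem (by exact hq), Set.indicator_of_notMem hq]

/-! ### The block update of `β` -/

section Block

variable {φ ψ κ : Vec p} {d e : ℝ}

theorem isMarkovKernel_blockKernel (hκ : ∀ j, 0 ≤ κ j) (hd : 0 < d) (he : 0 < e) :
    IsMarkovKernel (blockKernel φ ψ κ d e) := by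
  refine ⟨fun q => ?_⟩
  have : ∀ j, IsProbabilityMeasure (coordLaw (φ j) (ψ j) (κ j) d e (q.1 j) (q.2 j)) :=
    fun j => isProbabilityMeasure_coordLaw (hκ j) hd he
  exact Measure.isProbabilityMeasure_map (WithLp.measurable_toLp 2 _).aemeasurable

/-- The constant is the product of the coordinate normalizations. Its value is not needed later,
since total mass one determines it. -/
theorem exists_blockKernel_eq_smul (hκ : ∀ j, 0 ≤ κ j) (hd : 0 < d) (he : 0 < e) (q : Latent p) :
    ∃ c : ENNReal, blockKernel φ ψ κ d e q
      = c • (volume : Measure (Vec p)).withDensity fun β => jointDensity φ ψ κ d e (β, q) := by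
  set w : Fin p → ENNReal := fun j => ENNReal.ofReal
    (∑ b : SignType, compWeight (φ j) (ψ j) (κ j) d e (q.1 j) (q.2 j) b)⁻¹ with hw
  have hcd : ∀ j, Measurable fun x => ENNReal.ofReal
      (coordDensity (φ j) (ψ j) (κ j) d e (q.1 j) (q.2 j) x) :=
    fun j => (measurable_coordDensity _ _ _ _ _ _ _).ennreal_ofReal
  have hc : ∀ j, coordLaw (φ j) (ψ j) (κ j) d e (q.1 j) (q.2 j)
      = (volume : Measure ℝ).withDensity
        (w j • fun x => ENNReal.ofReal (coordDensity (φ j) (ψ j) (κ j) d e (q.1 j) (q.2 j) x)) :=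
    fun j => by
      rw [withDensity_smul _ (hcd j), coordLaw_eq_smul_withDensity (hκ j) hd he]
  have hfin : ∀ j, IsFiniteMeasure ((volume : Measure ℝ).withDensity
      (w j • fun x => ENNReal.ofReal
        (coordDensity (φ j) (ψ j) (κ j) d e (q.1 j) (q.2 j) x))) := fun j => by
    rw [← hc]; infer_instance
  refine ⟨∏ j, w j, ?_⟩
  have hj : Measurable fun β : Vec p => jointDensity φ ψ κ d e (β, q) :=
    (measurable_jointDensity φ ψ κ d e).comp measurable_prodMk_right
  change blockLaw φ ψ κ d e q = _
  rw [blockLaw, ← withDensity_smul _ hj,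
    ← (PiLp.volume_preserving_toLp (Fin p)).map_eq,
    ← map_withDensity_comp (WithLp.measurable_toLp 2 _) _ (hj.const_smul _)]
  congr 1
  simp_rw [hc]
  rw [pi_withDensity_eq _ fun j => (hcd j).const_smul _]
  congr 1
  ext x
  simp only [Pi.smul_apply, smul_eq_mul, Finset.prod_mul_distrib, Function.comp_apply,
    jointDensity]

theorem withDensity_jointDensity (hκ : ∀ j, 0 ≤ κ j) (hd : 0 < d) (he : 0 < e) (q : Latent p) :
    (volume : Measure (Vec p)).withDensity (fun β => jointDensity φ ψ κ d e (β, q))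
      = (∫⁻ β, jointDensity φ ψ κ d e (β, q)) • blockKernel φ ψ κ d e q := by
  obtain ⟨c, hc⟩ := exists_blockKernel_eq_smul (φ := φ) (ψ := ψ) hκ hd he q
  have hM := isMarkovKernel_blockKernel (φ := φ) (ψ := ψ) hκ hd he
  have h1 : blockKernel φ ψ κ d e q Set.univ = 1 := measure_univ
  rw [hc, Measure.smul_apply, withDensity_apply _ .univ, Measure.restrict_univ, smul_eq_mul] at h1
  rw [hc, smul_smul, mul_comm, h1, one_smul]

theorem map_swap_jointPosterior {M H : Matrix (Fin p) (Fin p) ℝ}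
    (hM : M.IsHermitian) (hH : H.IsHermitian) (hd : ‖matMap M‖ ≤ d) (he : ‖matMap H‖ ≤ e)
    (hd0 : 0 < d) (he0 : 0 < e) (hκ : ∀ j, 0 ≤ κ j)
    (h : Integrable (posteriorDensity M H φ ψ κ) volume) :
    (posterior M H φ ψ κ ⊗ₘ latentKernel M H κ d e).map Prod.swap
      = ((posterior M H φ ψ κ).bind (latentKernel M H κ d e)) ⊗ₘ blockKernel φ ψ κ d e := by
  have := isProbabilityMeasure_posterior h
  have := isMarkovKernel_blockKernel (φ := φ) (ψ := ψ) hκ hd0 he0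
  exact map_swap_compProd_eq_of_density _ volume (latentReference M H d e) _ _
    (measurable_jointDensity φ ψ κ d e) _ (jointPosterior_eq_smul_withDensity hM hH hd he h)
    (withDensity_jointDensity hκ hd0 he0)

theorem norm_le_sum_abs (x : Vec p) : ‖x‖ ≤ ∑ j, |x j| := by
  conv_lhs => rw [← (EuclideanSpace.basisFun (Fin p) ℝ).sum_repr x]
  refine (norm_sum_le _ _).trans (Finset.sum_le_sum fun j _ => ?_)
  rw [norm_smul, OrthonormalBasis.norm_eq_one, mul_one]
  exact le_rfl

/-- The mean norm of the block update is at most that of `(r + t) / (d + e)`, up to a constant. -/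
theorem exists_lintegral_norm_blockKernel_le (φ ψ : Vec p) (hκ : ∀ j, 0 ≤ κ j) (hd : 0 < d)
    (he : 0 < e) :
    ∃ C : ℝ, 0 ≤ C ∧ ∀ q : Latent p, ∫⁻ β, ENNReal.ofReal ‖β‖ ∂blockKernel φ ψ κ d e q
      ≤ ENNReal.ofReal (‖q.1 + q.2‖ / (d + e) + C) := by
  set c : Fin p → ℝ := fun j => (|φ j| + |ψ j| + d * κ j) / (d + e) + κ j with hc
  have hc0 : ∀ j, 0 ≤ c j := fun j => by
    have := hκ j
    simp only [hc]; positivity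
  have hu := halfNormalMean_nonneg (d + e)
  have hde : 0 < d + e := by positivity
  refine ⟨∑ j, (c j + 3 * halfNormalMean (d + e)), Finset.sum_nonneg fun j _ => by
    have := hc0 j; positivity, fun q => ?_⟩
  have hprob : ∀ j, IsProbabilityMeasure (coordLaw (φ j) (ψ j) (κ j) d e (q.1 j) (q.2 j)) :=
    fun j => isProbabilityMeasure_coordLaw (hκ j) hd he
  set w : Fin p → ℝ := fun j => |q.1 j + q.2 j| / (d + e) with hw
  -- The vector `w` stays in the Euclidean norm, so that `‖q.1 + q.2‖` keeps the coefficient `1 / (d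
  -- + e)`. Only the offsets and excesses are bounded by the cruder sum of absolute values.
  have hpt : ∀ x : Fin p → ℝ, ENNReal.ofReal ‖(WithLp.toLp 2 x : Vec p)‖
      ≤ ENNReal.ofReal (‖q.1 + q.2‖ / (d + e)) +
        ∑ j, (ENNReal.ofReal (c j) + ENNReal.ofReal (|x j| - (w j + c j))) := by
    intro x
    set X : Fin p → ℝ := fun j => max (|x j| - (w j + c j)) 0 with hX
    have h1 : ‖(WithLp.toLp 2 x : Vec p)‖
        ≤ ‖(WithLp.toLp 2 w : Vec p) + WithLp.toLp 2 fun j => c j + X j‖ := by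
      refine norm_le_norm_of_abs_le fun j => ?_
      change |x j| ≤ |w j + (c j + X j)|
      have h2 : |x j| - (w j + c j) ≤ X j := le_max_left _ _
      exact le_trans (by linarith) (le_abs_self _)
    have h2 : ‖(WithLp.toLp 2 w : Vec p)‖ ≤ ‖q.1 + q.2‖ / (d + e) := by
      have h3 : ‖(WithLp.toLp 2 w : Vec p)‖ ≤ ‖(d + e)⁻¹ • (q.1 + q.2)‖ := by
        refine norm_le_norm_of_abs_le fun j => ?_
        change |(|q.1 j + q.2 j| / (d + e))| ≤ |(d + e)⁻¹ * (q.1 j + q.2 j)|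
        rw [abs_div, abs_abs, abs_mul, abs_inv, div_eq_inv_mul]
      rwa [norm_smul, norm_inv, Real.norm_of_nonneg hde.le, ← div_eq_inv_mul] at h3
    have h3 : ‖(WithLp.toLp 2 fun j => c j + X j : Vec p)‖ ≤ ∑ j, (c j + X j) := by
      refine (norm_le_sum_abs _).trans (Finset.sum_le_sum fun j _ => ?_)
      exact (abs_of_nonneg (add_nonneg (hc0 j) (le_max_right _ _))).le
    have h4 : ∀ j, ENNReal.ofReal (|x j| - (w j + c j)) = ENNReal.ofReal (X j) := fun j => by
      simp [hX, ENNReal.ofReal_max]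
    have h5 : ∀ j, ENNReal.ofReal (c j) + ENNReal.ofReal (|x j| - (w j + c j))
        = ENNReal.ofReal (c j + X j) := fun j => by
      rw [h4, ENNReal.ofReal_add (hc0 j) (le_max_right _ _)]
    simp only [h5]
    rw [← ENNReal.ofReal_sum_of_nonneg fun j _ => add_nonneg (hc0 j) (le_max_right _ _),
      ← ENNReal.ofReal_add (by positivity)
        (Finset.sum_nonneg fun j _ => add_nonneg (hc0 j) (le_max_right _ _))]
    exact ENNReal.ofReal_le_ofReal (h1.trans ((norm_add_le _ _).trans (add_le_add h2 h3)))
  change ∫⁻ β, ENNReal.ofReal ‖β‖ ∂blockLaw φ ψ κ d e q ≤ _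
  rw [blockLaw, lintegral_map (by fun_prop) (WithLp.measurable_toLp 2 _)]
  refine (lintegral_mono hpt).trans ?_
  rw [lintegral_add_left measurable_const, lintegral_finsetSum _ fun j _ => by fun_prop,
    ENNReal.ofReal_add (by positivity) (Finset.sum_nonneg fun j _ => by
      have := hc0 j; positivity), lintegral_const, measure_univ, mul_one,
    ENNReal.ofReal_sum_of_nonneg fun j _ => by have := hc0 j; positivity]
  gcongr with j _
  rw [lintegral_add_left measurable_const, lintegral_const, measure_univ, mul_one,
    ENNReal.ofReal_add (hc0 j) (by positivity), ENNReal.ofReal_mul (by norm_num)]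
  gcongr
  have h5 := (measurePreserving_eval
    (fun j => coordLaw (φ j) (ψ j) (κ j) d e (q.1 j) (q.2 j)) j).lintegral_comp
    (f := fun y : ℝ => ENNReal.ofReal (|y| - (w j + c j))) (by fun_prop)
  refine (le_of_eq h5).trans ((lintegral_abs_sub_coordLaw_le (hκ j) hd he).trans (le_of_eq ?_))
  norm_num

end Block

/-! ### Drift and minorization -/

/-- Replacing `θ` by `β` in the mean of `r + t` costs at most `d * ‖κ‖`, and the resulting linear
map is a strict contraction of `(d + e) β`. The Gaussian fluctuations around the means have a mean
norm independent of `β`. -/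
theorem exists_lintegral_norm_latentKernel_le {M H : Matrix (Fin p) (Fin p) ℝ} {κ : Vec p}
    {d e : ℝ} (hM : M.PosSemidef) (hH : H.PosSemidef) (hκ : ∀ j, 0 ≤ κ j)
    (hd : ‖matMap M‖ < d) (he : ‖matMap H‖ < e)
    (hnull : ∀ v : Vec p, matMap M v = 0 → matMap H v = 0 → v = 0) :
    ∃ l C : ℝ, 0 ≤ l ∧ l < 1 ∧ 0 ≤ C ∧ ∀ β : Vec p,
      ∫⁻ q, ENNReal.ofReal (‖q.1 + q.2‖ / (d + e)) ∂latentKernel M H κ d e β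
        ≤ ENNReal.ofReal (l * ‖β‖ + C) := by
  have hd0 : 0 < d := (norm_nonneg _).trans_lt hd
  have he0 : 0 < e := (norm_nonneg _).trans_lt he
  have hde : 0 < d + e := by positivity
  obtain ⟨l, hl0, hl1, hl⟩ := exists_norm_sub_matMap_le hM hH hd he hnull
  set Sd := d • (1 : Matrix (Fin p) (Fin p) ℝ) - M with hSd
  set Se := e • (1 : Matrix (Fin p) (Fin p) ℝ) - H with hSe
  set gd := (∫⁻ y, ENNReal.ofReal ‖y‖ ∂multivariateGaussian (0 : Vec p) Sd).toReal with hgd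
  set ge := (∫⁻ y, ENNReal.ofReal ‖y‖ ∂multivariateGaussian (0 : Vec p) Se).toReal with hge
  have hcent : ∀ (m : Vec p) (S : Matrix (Fin p) (Fin p) ℝ),
      ∫⁻ y, ENNReal.ofReal ‖y - m‖ ∂multivariateGaussian m S
        = ENNReal.ofReal (∫⁻ y, ENNReal.ofReal ‖y‖ ∂multivariateGaussian (0 : Vec p) S).toReal := by
    intro m S
    rw [multivariateGaussian_eq_map_add, lintegral_map (by fun_prop) (by fun_prop)]
    simp only [add_sub_cancel_left]
    rw [ENNReal.ofReal_toReal (lintegral_norm_multivariateGaussian_lt_top S).ne]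
  have hgd0 : 0 ≤ gd := ENNReal.toReal_nonneg
  have hge0 : 0 ≤ ge := ENNReal.toReal_nonneg
  refine ⟨l, (d * ‖κ‖ + gd + ge) / (d + e), hl0, hl1, by positivity, fun β => ?_⟩
  set θ := softThreshold κ β with hθ
  have hmean : ‖matMap Sd θ + matMap Se β‖ ≤ l * (d + e) * ‖β‖ + d * ‖κ‖ := by
    have h1 : matMap Sd θ + matMap Se β
        = ((d • β - matMap M β) + (e • β - matMap H β)) + (d • (θ - β) - matMap M (θ - β)) := by
      rw [hSd, hSe, matMap_smul_one_sub_apply, matMap_smul_one_sub_apply, map_sub, smul_sub]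
      abel
    rw [h1]
    refine (norm_add_le _ _).trans (add_le_add (hl β) ((norm_smul_sub_matMap_le hM hd _).trans ?_))
    gcongr
    exact norm_softThreshold_sub_le hκ β
  have hpt : ∀ q : Latent p, ENNReal.ofReal (‖q.1 + q.2‖ / (d + e))
      ≤ ENNReal.ofReal (d + e)⁻¹ * (ENNReal.ofReal (l * (d + e) * ‖β‖ + d * ‖κ‖)
        + (ENNReal.ofReal ‖q.1 - matMap Sd θ‖ + ENNReal.ofReal ‖q.2 - matMap Se β‖)) := by
    intro q
    rw [← ENNReal.ofReal_add (norm_nonneg _) (norm_nonneg _), ← ENNReal.ofReal_add (by positivity)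
      (by positivity), ← ENNReal.ofReal_mul (by positivity), div_eq_inv_mul]
    refine ENNReal.ofReal_le_ofReal (mul_le_mul_of_nonneg_left ?_ (by positivity))
    have h2 : q.1 + q.2 = (matMap Sd θ + matMap Se β)
        + ((q.1 - matMap Sd θ) + (q.2 - matMap Se β)) := by abel
    rw [h2]
    exact (norm_add_le _ _).trans (add_le_add hmean (norm_add_le _ _))
  refine (lintegral_mono hpt).trans ?_
  have e1 : ∫⁻ q : Latent p, ENNReal.ofReal ‖q.1 - matMap Sd θ‖ ∂latentKernel M H κ d e β
      = ENNReal.ofReal gd := by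
    have h3 := (measurePreserving_fst (μ := multivariateGaussian (matMap Sd θ) Sd)
      (ν := multivariateGaussian (matMap Se β) Se)).lintegral_comp
      (f := fun y : Vec p => ENNReal.ofReal ‖y - matMap Sd θ‖) (by fun_prop)
    rw [hcent] at h3
    rw [latentKernel_apply]
    exact h3
  have e2 : ∫⁻ q : Latent p, ENNReal.ofReal ‖q.2 - matMap Se β‖ ∂latentKernel M H κ d e β
      = ENNReal.ofReal ge := by
    have h3 := (measurePreserving_snd (μ := multivariateGaussian (matMap Sd θ) Sd)
      (ν := multivariateGaussian (matMap Se β) Se)).lintegral_comp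
      (f := fun y : Vec p => ENNReal.ofReal ‖y - matMap Se β‖) (by fun_prop)
    rw [hcent] at h3
    rw [latentKernel_apply]
    exact h3
  rw [lintegral_const_mul _ (by fun_prop), lintegral_add_left measurable_const,
    lintegral_add_left (by fun_prop), e1, e2, lintegral_const, measure_univ, mul_one,
    ← ENNReal.ofReal_add hgd0 hge0, ← ENNReal.ofReal_add (by positivity) (by positivity),
    ← ENNReal.ofReal_mul (by positivity)]
  refine ENNReal.ofReal_le_ofReal (le_of_eq ?_)
  field_simp
  ring

/-- On bounded sets of `β`, the laws of `(r, t)` given `β` have a common nonzero component. -/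
theorem exists_le_latentKernel {M H : Matrix (Fin p) (Fin p) ℝ} {κ : Vec p} {d e : ℝ}
    (hM : M.IsHermitian) (hH : H.IsHermitian) (hκ : ∀ j, 0 ≤ κ j)
    (hd : ‖matMap M‖ ≤ d) (he : ‖matMap H‖ ≤ e) (R : ℝ) :
    ∃ ν : Measure (Latent p), IsFiniteMeasure ν ∧ ν Set.univ ≠ 0 ∧
      ∀ β : Vec p, ‖β‖ ≤ R → ν ≤ latentKernel M H κ d e β := by
  rcases lt_or_ge R 0 with hR | hR
  · exact ⟨latentKernel M H κ d e 0, inferInstance, by simp, fun β hβ =>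
      absurd ((norm_nonneg β).trans hβ) (not_le.2 hR)⟩
  set Sd := d • (1 : Matrix (Fin p) (Fin p) ℝ) - M with hSd
  set Se := e • (1 : Matrix (Fin p) (Fin p) ℝ) - H with hSe
  -- By Cauchy–Schwarz this bounds the Cameron–Martin densities from below, uniformly over the ball
  -- of radius `R`. Soft thresholding does not leave that ball.
  set h : Latent p → ENNReal := fun q => ENNReal.ofReal
    (Real.exp (-(‖q.1‖ * R) - ‖matMap Sd‖ * R ^ 2 / 2)
      * Real.exp (-(‖q.2‖ * R) - ‖matMap Se‖ * R ^ 2 / 2)) with hh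
  have hmeas : Measurable h := by fun_prop
  have hle : ∀ β : Vec p, ‖β‖ ≤ R →
      (latentReference M H d e).withDensity h ≤ latentKernel M H κ d e β := by
    intro β hβ
    rw [latentKernel_eq_withDensity hM hH hd he]
    refine withDensity_mono (Filter.Eventually.of_forall fun q => ENNReal.ofReal_le_ofReal ?_)
    have hθ := (norm_softThreshold_le hκ β).trans hβ
    have hterm : ∀ (S : Matrix (Fin p) (Fin p) ℝ) (x y : Vec p), ‖x‖ ≤ R →
        Real.exp (-(‖y‖ * R) - ‖matMap S‖ * R ^ 2 / 2)
          ≤ Real.exp (inner ℝ y x - inner ℝ x (matMap S x) / 2) := by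
      intro S x y hx
      refine Real.exp_le_exp.2 ?_
      have h1 := neg_le_inner_of_norm_le y hx
      have h2 := inner_matMap_le S x
      have h3 : ‖matMap S‖ * ‖x‖ ^ 2 ≤ ‖matMap S‖ * R ^ 2 := by gcongr
      linarith
    exact mul_le_mul (hterm Sd _ _ hθ) (hterm Se _ _ hβ) (Real.exp_pos _).le (Real.exp_pos _).le
  refine ⟨_, ⟨(hle 0 (by simpa using hR) _).trans_lt (measure_lt_top _ _)⟩, fun h0 => ?_, hle⟩
  rw [withDensity_apply _ .univ, Measure.restrict_univ, lintegral_eq_zero_iff hmeas] at h0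
  have h2 : ∀ᵐ _q ∂latentReference M H d e, False := by
    filter_upwards [h0] with q hq
    exact (ENNReal.ofReal_pos.2 (by positivity)).ne' hq
  exact NeZero.ne (latentReference M H d e) (by simpa using h2)

/-- The chain of `(r, t)` is geometrically ergodic. -/
theorem exists_tvDist_pow_marginal_le {M H : Matrix (Fin p) (Fin p) ℝ} {φ ψ κ : Vec p} {d e : ℝ}
    (hM : M.PosSemidef) (hH : H.PosSemidef) (hκ : ∀ j, 0 ≤ κ j)
    (hd : ‖matMap M‖ < d) (he : ‖matMap H‖ < e)
    (hproper : Integrable (posteriorDensity M H φ ψ κ) volume) :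
    ∃ γ : ℝ, 0 < γ ∧ γ < 1 ∧ ∃ C : Latent p → ℝ, ∀ (m : ℕ) (q : Latent p),
      tvDist (((latentKernel M H κ d e ∘ₖ blockKernel φ ψ κ d e) ^ m) q)
        ((posterior M H φ ψ κ ⊗ₘ latentKernel M H κ d e).map Prod.snd) ≤ C q * γ ^ m := by
  have hd0 : 0 < d := (norm_nonneg _).trans_lt hd
  have he0 : 0 < e := (norm_nonneg _).trans_lt he
  have hde : 0 < d + e := by positivity
  have hL := isMarkovKernel_blockKernel (φ := φ) (ψ := ψ) hκ hd0 he0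
  have hπ := isProbabilityMeasure_posterior hproper
  have hswap := map_swap_jointPosterior hM.1 hH.1 hd.le he.le hd0 he0 hκ hproper
  have : IsProbabilityMeasure ((posterior M H φ ψ κ ⊗ₘ latentKernel M H κ d e).map Prod.snd) :=
    Measure.isProbabilityMeasure_map measurable_snd.aemeasurable
  obtain ⟨Cb, hCb0, hCb⟩ := exists_lintegral_norm_blockKernel_le φ ψ hκ hd0 he0
  obtain ⟨l, Cl, hl0, hl1, hCl0, hCl⟩ := exists_lintegral_norm_latentKernel_le hM hH hκ hd he
    fun v => eq_zero_of_integrable_posteriorDensity hM.1 hH.1 hκ hproper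
  -- The Lyapunov function sees only `r + t`, so its sublevel sets are unbounded when `p > 0`. It
  -- still controls the mean norm of the next `β`, which is all that the minorization uses.
  refine exists_tvDist_pow_le_of_drift_of_minorization _ (invariant_comp_of_swap _ _ hswap)
    (V := fun q : Latent p => ‖q.1 + q.2‖ / (d + e)) (by fun_prop) (fun q => by positivity)
    (l := l) (K := l * Cb + Cl) hl0 hl1 (by positivity) (fun q => ?_) fun R => ?_
  · rw [Kernel.lintegral_comp _ _ _ (by fun_prop)]
    calc _ ≤ ∫⁻ β, ENNReal.ofReal (l * ‖β‖ + Cl) ∂blockKernel φ ψ κ d e q := lintegral_mono hCl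
      _ = ENNReal.ofReal l * ∫⁻ β, ENNReal.ofReal ‖β‖ ∂blockKernel φ ψ κ d e q
          + ENNReal.ofReal Cl := by
        rw [← lintegral_const_mul _ (by fun_prop)]
        have : ∀ β : Vec p, ENNReal.ofReal (l * ‖β‖ + Cl)
            = ENNReal.ofReal l * ENNReal.ofReal ‖β‖ + ENNReal.ofReal Cl := fun β => by
          rw [ENNReal.ofReal_add (by positivity) hCl0, ENNReal.ofReal_mul hl0]
        simp only [this]
        rw [lintegral_add_right _ measurable_const, lintegral_const, measure_univ, mul_one]
      _ ≤ ENNReal.ofReal l * ENNReal.ofReal (‖q.1 + q.2‖ / (d + e) + Cb) + ENNReal.ofReal Cl := by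
        gcongr
        exact hCb q
      _ = _ := by
        rw [← ENNReal.ofReal_mul hl0, ← ENNReal.ofReal_add (by positivity) hCl0]
        congr 1
        ring
  -- `E` bounds the mean norm of `β` wherever `V ≤ R`, so by Markov's inequality the ball of radius
  -- `2 * E` has mass at least one half. Hence the minorizing measure is half of `ν`.
  · set E := max R 0 + Cb + 1 with hE
    have hE0 : 0 < E := by have := le_max_right R 0; linarith
    obtain ⟨ν, hνf, hν0, hν⟩ := exists_le_latentKernel (κ := κ) hM.1 hH.1 hκ hd.le he.le (2 * E)
    refine ⟨(2 : ENNReal)⁻¹ • ν, Measure.smul_finite ν (by simp), by simpa using hν0,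
      fun q hq => Measure.le_iff.2 fun A hA => ?_⟩
    have hS : MeasurableSet {β : Vec p | ‖β‖ ≤ 2 * E} := measurableSet_le measurable_norm
      measurable_const
    have htail : blockKernel φ ψ κ d e q {β : Vec p | ‖β‖ ≤ 2 * E}ᶜ ≤ 2⁻¹ := by
      have h1 := meas_ge_le_lintegral_div (μ := blockKernel φ ψ κ d e q)
        (f := fun β : Vec p => ENNReal.ofReal ‖β‖) (by fun_prop) (ε := ENNReal.ofReal (2 * E))
        (by simpa using hE0) ENNReal.ofReal_ne_top
      calc _ ≤ blockKernel φ ψ κ d e q {β | ENNReal.ofReal (2 * E) ≤ ENNReal.ofReal ‖β‖} :=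
            measure_mono fun β hβ => ENNReal.ofReal_le_ofReal (not_le.1 hβ).le
        _ ≤ (∫⁻ β, ENNReal.ofReal ‖β‖ ∂blockKernel φ ψ κ d e q) / ENNReal.ofReal (2 * E) := h1
        _ ≤ ENNReal.ofReal E / ENNReal.ofReal (2 * E) := by
          gcongr
          refine (hCb q).trans (ENNReal.ofReal_le_ofReal ?_)
          have := hq.trans (le_max_left R 0)
          linarith
        _ = 2⁻¹ := by
          rw [← ENNReal.ofReal_div_of_pos (by positivity)]
          have : E / (2 * E) = 2⁻¹ := by field_simp
          rw [this, ENNReal.ofReal_inv_of_pos two_pos, ENNReal.ofReal_ofNat]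
    have hhalf : 2⁻¹ ≤ blockKernel φ ψ κ d e q {β : Vec p | ‖β‖ ≤ 2 * E} := by
      have h1 := prob_add_prob_compl (μ := blockKernel φ ψ κ d e q) hS
      by_contra hlt
      have h2 := ENNReal.add_lt_add_of_lt_of_le (by simp) (not_le.1 hlt) htail
      rw [h1, ENNReal.inv_two_add_inv_two] at h2
      exact lt_irrefl _ h2
    rw [Kernel.comp_apply' _ _ _ hA, Measure.smul_apply, smul_eq_mul]
    calc 2⁻¹ * ν A ≤ blockKernel φ ψ κ d e q {β : Vec p | ‖β‖ ≤ 2 * E} * ν A := by gcongr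
      _ = ∫⁻ _β in {β : Vec p | ‖β‖ ≤ 2 * E}, ν A ∂blockKernel φ ψ κ d e q := by
        rw [setLIntegral_const, mul_comm]
      _ ≤ ∫⁻ β in {β : Vec p | ‖β‖ ≤ 2 * E}, latentKernel M H κ d e β A
            ∂blockKernel φ ψ κ d e q := setLIntegral_mono' hS fun β hβ => hν β hβ A
      _ ≤ _ := setLIntegral_le_lintegral _ _

end AntiCorr

end

/-! ### Geometric ergodicity of the full chain -/

theorem theorem3 {p : ℕ} (M H : Matrix (Fin p) (Fin p) ℝ) (φ ψ κ : Vec p) (d e : ℝ)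
    (hM : M.PosSemidef) (hH : H.PosSemidef) (hκ : ∀ j, 0 ≤ κ j)
    (hd : ‖matMap M‖ < d) (he : ‖matMap H‖ < e)
    (hproper : Integrable (posteriorDensity M H φ ψ κ) volume) :
    -- the chain is a Markov chain with the joint posterior as invariant distribution
    IsMarkovKernel (gibbsKernel M H φ ψ κ d e) ∧
    IsProbabilityMeasure (jointPosterior M H φ ψ κ d e) ∧
    (gibbsKernel M H φ ψ κ d e).Invariant (jointPosterior M H φ ψ κ d e) ∧
    -- one rate for the marginal chain of `(r, t)` and for the full chain
    (∃ γ : ℝ, 0 < γ ∧ γ < 1 ∧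
      (∃ C₁ : Latent p → ℝ, ∀ (m : ℕ) (β₀ : Vec p) (q₀ : Latent p),
        tvDist (((gibbsKernel M H φ ψ κ d e ^ m) (β₀, q₀)).map Prod.snd)
          ((jointPosterior M H φ ψ κ d e).map Prod.snd) ≤ C₁ q₀ * γ ^ m) ∧
      (∃ C₂ : Latent p → ℝ, ∀ (m : ℕ) (β₀ : Vec p) (q₀ : Latent p),
        tvDist ((gibbsKernel M H φ ψ κ d e ^ m) (β₀, q₀))
          (jointPosterior M H φ ψ κ d e) ≤ C₂ q₀ * γ ^ m)) ∧
    -- every rate of the marginal chain is a rate of the full chain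
    (∀ γ : ℝ, 0 < γ → γ < 1 →
      (∃ C₁ : Latent p → ℝ, ∀ (m : ℕ) (β₀ : Vec p) (q₀ : Latent p),
        tvDist (((gibbsKernel M H φ ψ κ d e ^ m) (β₀, q₀)).map Prod.snd)
          ((jointPosterior M H φ ψ κ d e).map Prod.snd) ≤ C₁ q₀ * γ ^ m) →
      (∃ C₂ : Latent p → ℝ, ∀ (m : ℕ) (β₀ : Vec p) (q₀ : Latent p),
        tvDist ((gibbsKernel M H φ ψ κ d e ^ m) (β₀, q₀))
          (jointPosterior M H φ ψ κ d e) ≤ C₂ q₀ * γ ^ m)) := by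
  have hd0 : 0 < d := (norm_nonneg _).trans_lt hd
  have he0 : 0 < e := (norm_nonneg _).trans_lt he
  have hL := isMarkovKernel_blockKernel (φ := φ) (ψ := ψ) hκ hd0 he0
  have hπ := isProbabilityMeasure_posterior hproper
  have hswap := map_swap_jointPosterior hM.1 hH.1 hd.le he.le hd0 he0 hκ hproper
  obtain ⟨γ, hγ0, hγ1, C, hC⟩ := exists_tvDist_pow_marginal_le hM hH hκ hd he hproper
  -- The `(r, t)`-component evolves autonomously under `latentKernel ∘ₖ blockKernel`, so the Harris
  -- bound for that kernel applies whatever `β₀` is.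
  have hmarg : ∀ (m : ℕ) (β₀ : Vec p) (q₀ : Latent p),
      tvDist (((gibbsKernel M H φ ψ κ d e ^ m) (β₀, q₀)).map Prod.snd)
        ((jointPosterior M H φ ψ κ d e).map Prod.snd) ≤ C q₀ * γ ^ m := fun m β₀ q₀ => by
    have h := map_snd_pow_gibbs (latentKernel M H κ d e) (blockKernel φ ψ κ d e) m β₀ q₀
    rw [gibbsKernel, h]
    exact hC m q₀
  have htransfer : ∀ γ : ℝ, 0 < γ → (∃ C₁ : Latent p → ℝ, ∀ (m : ℕ) (β₀ : Vec p) (q₀ : Latent p),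
      tvDist (((gibbsKernel M H φ ψ κ d e ^ m) (β₀, q₀)).map Prod.snd)
        ((jointPosterior M H φ ψ κ d e).map Prod.snd) ≤ C₁ q₀ * γ ^ m) →
      ∃ C₂ : Latent p → ℝ, ∀ (m : ℕ) (β₀ : Vec p) (q₀ : Latent p),
        tvDist ((gibbsKernel M H φ ψ κ d e ^ m) (β₀, q₀))
          (jointPosterior M H φ ψ κ d e) ≤ C₂ q₀ * γ ^ m := fun γ hγ ⟨C₁, hC₁⟩ =>
    exists_tvDist_pow_gibbs_le (latentKernel M H κ d e) (blockKernel φ ψ κ d e) hswap hγ hC₁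
  refine ⟨?_, ?_, invariant_gibbs_of_swap _ _ hswap, ⟨γ, hγ0, hγ1, ⟨C, hmarg⟩,
    htransfer γ hγ0 ⟨C, hmarg⟩⟩, fun γ hγ _ => htransfer γ hγ⟩
  · unfold gibbsKernel; infer_instance
  · unfold jointPosterior; infer_instance
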